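/- Let $g:(-\pi^2,\infty)\to(0,\infty)$ be the increasing bijection $g(r)=\sinh(\sqrt r)/\sqrt r$ for $r>0$, $g(0)=1$, $g(r)=\sin(\sqrt{-r})/\sqrt{-r}$ for $-\pi^2<r<0$, and for $\eta>0$ let $$G(\eta)=2\eta-2\,\mathrm{sgn}\big(4g^{-1}(\eta^{-1})+\pi^2\big)\sqrt{\eta^2+g^{-1}(\eta^{-1})}+g^{-1}(\eta^{-1}).$$ For real coefficients $a_n,b_n$, $n\ge2$, put $$G_n(\eta)=a_n\mathbf 1_{]1,\infty[}(\eta)\frac{(\eta-1)^n}{\eta^{n-1}}+b_n\mathbf 1_{]0,1[}(\eta)\frac{(-\log\eta)^n}{(1-\log\eta)^{n-2}} .$$ There is exactly one choice of $(a_n,b_n)_{n\ge2}$ such that for every $n\ge1$ the functions $G$ and $\sum_{k=2}^nG_k$ are $n$ times continuously differentiable near $\eta=1$ and $$\frac{d^n}{d\eta^n}G(\eta)\Big|_{\eta=1}=\frac{d^n}{d\eta^n}\sum_{k=2}^{n}G_k(\eta)\Big|_{\eta=1}.$$ With these coefficients the following hold. 1. For every $\eta>1$, $\sum_{n=2}^NG_n(\eta)\to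 G(\eta)$ as $N\to\infty$. 2. Let $\sigma>0$, $z=(t,x_1,x_2)$, $w=(T,y_1,y_2)$ with $t<T$, $x_1,y_1>0$, $x_2<y_2$, and $h(z;w)=\frac{(T-t)\sqrt{x_1y_1}}{y_2-x_2}$. Let $\Psi(z;w)$ be the infimum of $\int_t^T|\omega(s)|^2ds$ over the real-valued controls $\omega\in L^2([t,T])$ for which $\dot\gamma_1=\sigma\omega\gamma_1$, $\dot\gamma_2=\gamma_1$ has an absolutely continuous solution on $[t,T]$ with $\gamma(t)=(x_1,x_2)$ and $\gamma(T)=(y_1,y_2)$. If $h(z;w)>1$, then the infimum is attained, $$\Psi(z;w)=\frac{4}{\sigma^2(T-t)}\Big[h(z;w)\Big(\sqrt{\tfrac{y_1}{x_1}}+\sqrt{\tfrac{x_1}{y_1}}-2\Big)+G(h(z;w))\Big],$$ and $\Psi_N(z;w)\to\Psi(z;w)$ as $N\to\infty$, where $$\Psi_N(z;w)=\frac{4}{\sigma^2(T-t)}\Big[h(z;w)\Big(\sqrt{\tfrac{y_1}{x_1}}+\sqrt{\tfrac{x_1}{y_1}}-2\Big)+\sum_{n=2}^NG_n(h(z;w))\Big].$$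 3. The function $F(\xi)=(1-\xi)\,G\big(\tfrac1{1-\xi}\big)$, $\xi\in(-1,1)$, extends to a holomorphic function on the unit disc $\{\xi\in\mathbb C:|\xi|<1\}$. -/

import Mathlib

namespace ExpBM

/-- `g r = sinh √r / √r`, read as `1` at `r = 0` and as `sin √(-r) / √(-r)` for `r < 0`.
It is used on `(-π², ∞)`, which it maps bijectively onto `(0, ∞)`. -/
noncomputable def g (r : ℝ) : ℝ :=
  if 0 < r then Real.sinh (Real.sqrt r) / Real.sqrt r
  else if r = 0 then 1
  else Real.sin (Real.sqrt (-r)) / Real.sqrt (-r)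

/-- The inverse of `g : (-π², ∞) → (0, ∞)`. -/
noncomputable def gInv : ℝ → ℝ :=
  Function.invFunOn g (Set.Ioi (-(Real.pi ^ 2)))

/-- The function `G` (meaningful for `η > 0`). -/
noncomputable def G (η : ℝ) : ℝ :=
  2 * η - 2 * Real.sign (4 * gInv η⁻¹ + Real.pi ^ 2) * Real.sqrt (η ^ 2 + gInv η⁻¹) + gInv η⁻¹

/-- The `n`-th term `G_n` of the expansion of `G` (for `n ≥ 2`), with coefficient sequences
`a` and `b`. -/
noncomputable def GTerm (a b : ℕ → ℝ) (n : ℕ) (η : ℝ) : ℝ :=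
  a n * (Set.Ioi (1 : ℝ)).indicator (fun u => (u - 1) ^ n / u ^ (n - 1)) η
    + b n * (Set.Ioo (0 : ℝ) 1).indicator
        (fun u => (-Real.log u) ^ n / (1 - Real.log u) ^ (n - 2)) η

/-- The partial sum `∑_{n=2}^N G_n`. -/
noncomputable def GSum (a b : ℕ → ℝ) (N : ℕ) (η : ℝ) : ℝ :=
  ∑ n ∈ Finset.Icc 2 N, GTerm a b n η

/-- The equations that determine `(a_n, b_n)_{n ≥ 2}`: for every `n ≥ 1` the `n`-th (two-sided)
derivatives of `G` and of `∑_{k=2}^n G_k` at `η = 1` exist and coincide. -/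
def IsCoeffs (a b : ℕ → ℝ) : Prop :=
  ∀ n : ℕ, 1 ≤ n →
    ContDiffAt ℝ n G 1 ∧ ContDiffAt ℝ n (GSum a b n) 1 ∧
      iteratedDeriv n G 1 = iteratedDeriv n (GSum a b n) 1

/-- `h(z;w) = (T - t) √(x₁ y₁) / (y₂ - x₂)` for `z = (t, x₁, x₂)` and `w = (T, y₁, y₂)`. -/
noncomputable def h (t x₁ x₂ T y₁ y₂ : ℝ) : ℝ :=
  (T - t) * Real.sqrt (x₁ * y₁) / (y₂ - x₂)

/-- The control `ω ∈ L²([t,T])` is admissible: the system `γ₁' = σ ω γ₁`, `γ₂' = γ₁` on `[t,T]`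
has an (absolutely continuous) solution from `(x₁, x₂)` at time `t` to `(y₁, y₂)` at time `T`.
The system is written in its integrated form. -/
def IsAdmissible (σ t x₁ x₂ T y₁ y₂ : ℝ) (ω : ℝ → ℝ) : Prop :=
  MeasureTheory.MemLp ω 2 (MeasureTheory.volume.restrict (Set.Icc t T)) ∧
    ∃ γ₁ γ₂ : ℝ → ℝ,
      ContinuousOn γ₁ (Set.Icc t T) ∧ ContinuousOn γ₂ (Set.Icc t T) ∧
      (∀ s ∈ Set.Icc t T, γ₁ s = x₁ + ∫ τ in t..s, σ * ω τ * γ₁ τ) ∧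
      (∀ s ∈ Set.Icc t T, γ₂ s = x₂ + ∫ τ in t..s, γ₁ τ) ∧
      γ₁ T = y₁ ∧ γ₂ T = y₂

/-- The costs `∫_t^T |ω(s)|² ds` of the admissible controls. -/
def costs (σ t x₁ x₂ T y₁ y₂ : ℝ) : Set ℝ :=
  {c | ∃ ω : ℝ → ℝ, IsAdmissible σ t x₁ x₂ T y₁ y₂ ω ∧ c = ∫ s in t..T, |ω s| ^ 2}

/-- The optimal cost `Ψ(z;w)` of the control problem. -/
noncomputable def Psi (σ t x₁ x₂ T y₁ y₂ : ℝ) : ℝ :=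
  sInf (costs σ t x₁ x₂ T y₁ y₂)

/-- The `N`-th order expansion `Ψ_N(z;w)`. -/
noncomputable def PsiN (a b : ℕ → ℝ) (N : ℕ) (σ t x₁ x₂ T y₁ y₂ : ℝ) : ℝ :=
  4 / (σ ^ 2 * (T - t)) *
    (h t x₁ x₂ T y₁ y₂ * (Real.sqrt (y₁ / x₁) + Real.sqrt (x₁ / y₁) - 2)
      + GSum a b N (h t x₁ x₂ T y₁ y₂))

end ExpBM

/-! Everything about `G` rests on a holomorphic inverse of `g`. The entire function `E` extends `g`,
and `r = -s ^ 2` turns `E r` into `sin s / s` and the parabolic region `‖r‖ - re r < 2π²` into the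
strip `|re s| < π`. There `E' = 0 ≠ E` would force `tan s = s` with `s ≠ 0`, which is impossible; `E
= 1` occurs only at `0`; and the bounding parabola is sent into `re ≤ 0`. So `E` is proper and
locally biholomorphic from the part of the region where `re E > 0` onto the right half-plane, with
one simple fibre, and has a holomorphic inverse `ψ` (`exists_inverse_E`).

Half-angle formulas write `G` through `r` and `g (r / 4)` with no square root or sign (`G_eq`), so
`F` extends to the disc because `1 - ξ` stays in the right half-plane. With `ξ = 1 - 1 / η` the
Taylor series of `F` is the expansion for `η > 1`, and its coefficients are the `a n`. The variable
`ζ = -log η / (1 - log η)` gives the `b n` in the same way. On each side of `1` the remainder is `(η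
- 1) ^ (n + 1)` times an analytic function, hence `C^n` across `1` with zero `n`-th derivative;
uniqueness is read off from one-sided derivatives.

For the control problem the extremal is `γ₁ = 1 / v ^ 2` with `v'' = -α² v`. Writing any competitor
as `exp ψ / v ^ 2`, integration by parts and `1 + ψ ≤ exp ψ` prove that it costs at least as much
(`integral_sq_le_of_trajectory`). -/

section

open Complex Filter Topology Set

namespace ExpBM

/-! ### The entire function `E` and its behaviour on the parabolic region. -/

/-- The coefficients of the entire function `sinc √(-r)`. -/
noncomputable def coefE (n : ℕ) : ℂ := (((2 * n + 1).factorial : ℂ))⁻¹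

/-- The entire function `E` with `E (-s ^ 2) = sin s / s`, which extends `g`. -/
noncomputable def E : ℂ → ℂ := FormalMultilinearSeries.ofScalarsSum coefE

lemma radius_E : (FormalMultilinearSeries.ofScalars ℂ coefE).radius = ⊤ := by
  apply FormalMultilinearSeries.ofScalars_radius_eq_top_of_tendsto
  · exact Eventually.of_forall fun n => inv_ne_zero (by exact_mod_cast (Nat.factorial_ne_zero _))
  · have h1 : ∀ n : ℕ, ‖coefE n.succ‖ / ‖coefE n‖ = 1 / ((2 * n + 3) * (2 * n + 2) : ℝ) := by
      intro n
      have h2 : (2 * n.succ + 1).factorial = (2 * n + 3) * ((2 * n + 2) * (2 * n + 1).factorial) := by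
        rw [show 2 * n.succ + 1 = (2 * n + 1 + 1) + 1 by rfl, Nat.factorial_succ, Nat.factorial_succ]
      have h3 : ((2 * n + 1).factorial : ℝ) ≠ 0 := by exact_mod_cast (Nat.factorial_ne_zero _)
      simp only [coefE, norm_inv, Complex.norm_natCast, h2]
      push_cast
      field_simp
    simp_rw [h1]
    refine squeeze_zero (fun n => by positivity) (fun n => ?_)
      tendsto_one_div_add_atTop_nhds_zero_nat
    apply one_div_le_one_div_of_le (by positivity)
    have : (0 : ℝ) ≤ n := n.cast_nonneg
    nlinarith

lemma hasFPowerSeriesOnBall_E :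
    HasFPowerSeriesOnBall E (FormalMultilinearSeries.ofScalars ℂ coefE) 0 ⊤ := by
  have h := (FormalMultilinearSeries.ofScalars ℂ coefE).hasFPowerSeriesOnBall
    (by rw [radius_E]; exact ENNReal.zero_lt_top)
  rw [radius_E] at h
  exact h

lemma differentiable_E : Differentiable ℂ E := by
  intro z
  exact (hasFPowerSeriesOnBall_E.analyticOnNhd z (by simp)).differentiableAt

lemma hasSum_E (z : ℂ) : HasSum (fun n => coefE n * z ^ n) (E z) := by
  have h := hasFPowerSeriesOnBall_E.hasSum (y := z) (by simp)
  simpa [FormalMultilinearSeries.ofScalars_apply_eq, zero_add, smul_eq_mul, mul_comm] using h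

lemma E_zero : E 0 = 1 := by
  have h := hasSum_E 0
  refine h.unique ?_
  convert hasSum_single (f := fun n => coefE n * (0 : ℂ) ^ n) 0 (fun n hn => by simp [hn]) using 1
  simp [coefE]

lemma deriv_E_zero : deriv E 0 = 1 / 6 := by
  rw [hasFPowerSeriesOnBall_E.hasFPowerSeriesAt.deriv]
  simp [coefE, Nat.factorial]

lemma mul_E_neg_sq (s : ℂ) : s * E (-s ^ 2) = Complex.sin s := by
  refine (HasSum.mul_left s (hasSum_E (-s ^ 2))).unique ?_
  refine (Complex.hasSum_sin s).congr_fun fun n => ?_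
  rw [coefE]
  rw [neg_pow, ← pow_mul, pow_succ]
  field_simp

lemma mul_E_sq (s : ℂ) : s * E (s ^ 2) = Complex.sinh s := by
  have h := mul_E_neg_sq (s * I)
  rw [Complex.sin_mul_I, mul_pow, I_sq, mul_neg_one, neg_neg, mul_right_comm] at h
  exact mul_right_cancel₀ I_ne_zero h

lemma E_neg_sq {s : ℂ} (hs : s ≠ 0) : E (-s ^ 2) = Complex.sin s / s := by
  rw [← mul_E_neg_sq]; field_simp

lemma E_add_deriv (s : ℂ) : E (-s ^ 2) - 2 * s ^ 2 * deriv E (-s ^ 2) = Complex.cos s := by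
  have h1 : HasDerivAt (fun s : ℂ => s * E (-s ^ 2))
      (1 * E (-s ^ 2) + s * (deriv E (-s ^ 2) * (-(2 * s)))) s := by
    refine (hasDerivAt_id s).mul ?_
    have := (differentiable_E (-s ^ 2)).hasDerivAt
    refine HasDerivAt.comp s this ?_
    simpa using (hasDerivAt_pow 2 s).fun_neg
  have h2 : (fun s : ℂ => s * E (-s ^ 2)) = Complex.sin := funext mul_E_neg_sq
  rw [h2] at h1
  rw [← h1.unique (Complex.hasDerivAt_sin s)]
  ring

lemma exists_neg_sq_eq (r : ℂ) : ∃ s : ℂ, 0 ≤ s.re ∧ r = -s ^ 2 := by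
  obtain ⟨s, hs⟩ := IsAlgClosed.exists_pow_nat_eq (-r) (n := 2) (by norm_num)
  rcases le_total 0 s.re with h | h
  · exact ⟨s, h, by rw [hs, neg_neg]⟩
  · exact ⟨-s, by simpa using h, by rw [neg_sq, hs, neg_neg]⟩

/-- Translates the parabola `‖r‖ - re r = 2π²` into the line `re s = π`. -/
lemma norm_sub_re_neg_sq (s : ℂ) : ‖-s ^ 2‖ - (-s ^ 2).re = 2 * s.re ^ 2 := by
  rw [norm_neg, norm_pow, ← Complex.normSq_eq_norm_sq, Complex.normSq_apply]
  simp [pow_two]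
  ring

lemma sinh_lt_mul_cosh {y : ℝ} (hy : 0 < y) : Real.sinh y < y * Real.cosh y := by
  have hmono : StrictMonoOn (fun y : ℝ => y * Real.cosh y - Real.sinh y) (Ici 0) := by
    apply strictMonoOn_of_deriv_pos (convex_Ici 0) (by fun_prop)
    intro x hx
    rw [interior_Ici] at hx
    have : HasDerivAt (fun y : ℝ => y * Real.cosh y - Real.sinh y)
        (1 * Real.cosh x + x * Real.sinh x - Real.cosh x) x :=
      ((hasDerivAt_id x).mul (Real.hasDerivAt_cosh x)).sub (Real.hasDerivAt_sinh x)
    rw [this.deriv]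
    have := mul_pos hx (Real.sinh_pos_iff.2 hx)
    linarith
  have := hmono (by simp) hy.le hy
  simp at this
  linarith

lemma mul_cos_lt_sin {x : ℝ} (h0 : 0 < x) (h1 : x < Real.pi) : x * Real.cos x < Real.sin x := by
  rcases lt_or_ge x (Real.pi / 2) with h | h
  · have h2 := Real.lt_tan h0 h
    have h3 : 0 < Real.cos x := Real.cos_pos_of_mem_Ioo ⟨by linarith, h⟩
    rw [Real.tan_eq_sin_div_cos, lt_div_iff₀ h3] at h2
    exact h2
  · have := Real.cos_nonpos_of_pi_div_two_le_of_le h (by linarith [Real.pi_pos])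
    have := Real.sin_pos_of_pos_of_lt_pi h0 h1
    nlinarith

lemma sin_re (s : ℂ) : (Complex.sin s).re = Real.sin s.re * Real.cosh s.im := by
  conv_lhs => rw [Complex.sin_eq]
  simp [← ofReal_sin, ← ofReal_cos, ← ofReal_sinh, ← ofReal_cosh]

lemma sin_im (s : ℂ) : (Complex.sin s).im = Real.cos s.re * Real.sinh s.im := by
  conv_lhs => rw [Complex.sin_eq]
  simp [← ofReal_sin, ← ofReal_cos, ← ofReal_sinh, ← ofReal_cosh]

lemma cos_re (s : ℂ) : (Complex.cos s).re = Real.cos s.re * Real.cosh s.im := by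
  conv_lhs => rw [Complex.cos_eq]
  simp [← ofReal_sin, ← ofReal_cos, ← ofReal_sinh, ← ofReal_cosh]

lemma cos_im (s : ℂ) : (Complex.cos s).im = -(Real.sin s.re * Real.sinh s.im) := by
  conv_lhs => rw [Complex.cos_eq]
  simp [← ofReal_sin, ← ofReal_cos, ← ofReal_sinh, ← ofReal_cosh]

/-- `sinh (2 y) / (2 y) > 1` and `y cosh y > sinh y`, in a form symmetric in the sign of `y`. -/
lemma sq_lt_mul_sinh {y : ℝ} (hy : y ≠ 0) : y ^ 2 < y * Real.sinh y := by
  rcases lt_or_gt_of_ne hy with h | h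
  · have := Real.sinh_lt_self_iff.2 h
    nlinarith
  · have := Real.self_lt_sinh_iff.2 h
    nlinarith

lemma mul_sinh_lt {y : ℝ} (hy : y ≠ 0) : y * Real.sinh y < y ^ 2 * Real.cosh y := by
  rcases lt_or_gt_of_ne hy with h | h
  · have := sinh_lt_mul_cosh (neg_pos.2 h)
    rw [Real.sinh_neg, Real.cosh_neg] at this
    nlinarith
  · have := sinh_lt_mul_cosh h
    nlinarith

lemma eq_zero_of_sin_eq_self {s : ℂ} (h0 : 0 ≤ s.re) (h1 : s.re < Real.pi)
    (h : Complex.sin s = s) : s = 0 := by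
  have hr := congrArg Complex.re h
  have hi := congrArg Complex.im h
  rw [sin_re] at hr
  rw [sin_im] at hi
  set x := s.re
  set y := s.im
  -- If `y ≠ 0`, the imaginary part gives `y² = cos x · y sinh y < y² cos x cosh y`, while `x cos x
  -- < sin x` and the real part give `cos x cosh y < 1`.
  have hy : y = 0 := by
    by_contra hy
    have ha := sq_lt_mul_sinh hy
    have hb := mul_sinh_lt hy
    have hc := Real.cosh_pos y
    rcases h0.eq_or_lt with h0 | h0
    · rw [← h0, Real.cos_zero, one_mul] at hi
      rw [hi] at ha
      nlinarith
    have hx := mul_cos_lt_sin h0 h1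
    have hcos : y ^ 2 = Real.cos x * (y * Real.sinh y) := by
      linear_combination -y * hi
    have hpos : 0 < Real.cos x := by
      by_contra hn
      have : 0 < y ^ 2 := by positivity
      nlinarith
    have e1 : y ^ 2 * x * Real.cos x * Real.cosh y < y ^ 2 * x := by
      have : 0 < y ^ 2 * Real.cosh y := by positivity
      nlinarith
    have e2 : Real.cos x * (y * Real.sinh y) < Real.cos x * (y ^ 2 * Real.cosh y) := by
      gcongr
    nlinarith
  have hx : x = 0 := by
    rw [hy, Real.cosh_zero, mul_one] at hr
    rcases h0.eq_or_lt with h0 | h0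
    · exact h0.symm
    · exact absurd hr (Real.sin_lt h0).ne
  exact Complex.ext hx hy

lemma sin_ne_mul_cos {s : ℂ} (h0 : 0 ≤ s.re) (h1 : s.re < Real.pi) (hs : s ≠ 0)
    (hc : Complex.cos s ≠ 0) : Complex.sin s ≠ s * Complex.cos s := by
  intro h
  have hr := congrArg Complex.re h
  have hi := congrArg Complex.im h
  have hn : 0 < Complex.normSq (Complex.cos s) := Complex.normSq_pos.2 hc
  rw [Complex.normSq_apply, cos_re, cos_im] at hn
  rw [sin_re, Complex.mul_re, cos_re, cos_im] at hr
  rw [sin_im, Complex.mul_im, cos_re, cos_im] at hi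
  have hs' : s.re ≠ 0 ∨ s.im ≠ 0 := by
    by_contra hcon
    push Not at hcon
    exact hs (Complex.ext hcon.1 hcon.2)
  set x := s.re
  set y := s.im
  have p1 := Real.sin_sq_add_cos_sq x
  have p2 := Real.cosh_sq y
  set c := Real.cos x * Real.cosh y * (Real.cos x * Real.cosh y) +
    -(Real.sin x * Real.sinh y) * -(Real.sin x * Real.sinh y) with hcdef
  -- `k1` and `k2` are the real and imaginary parts of `sin s = s cos s` multiplied by the conjugate
  -- of `cos s`, with `c = |cos s|²`. Off the axes, `sinh 2y / 2y > 1` forces `c > 1` and `sin 2x <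
  -- 2x` forces `c < 1`.
  have k1 : Real.sin x * Real.cos x = x * c := by
    rw [hcdef]
    linear_combination (Real.cos x * Real.cosh y) * hr - (Real.sin x * Real.sinh y) * hi
      - Real.sin x * Real.cos x * p2
  have k2 : Real.sinh y * Real.cosh y = y * c := by
    rw [hcdef]
    linear_combination (Real.sin x * Real.sinh y) * hr + (Real.cos x * Real.cosh y) * hi
      - Real.sinh y * Real.cosh y * p1
  by_cases hy : y = 0
  · have hx : 0 < x := lt_of_le_of_ne h0 (by simpa [hy, eq_comm] using hs')
    rw [hy] at hr
    simp at hr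
    exact absurd hr (mul_cos_lt_sin hx h1).ne'
  · have hc1 : 1 < c := by
      have h2y := sq_lt_mul_sinh (mul_ne_zero two_ne_zero hy)
      rw [Real.sinh_two_mul] at h2y
      have h3 : y ^ 2 * 1 < y ^ 2 * c := by linear_combination h2y / 4 + y * k2
      exact lt_of_mul_lt_mul_left h3 (sq_nonneg y)
    rcases h0.eq_or_lt with hx | hx
    · rw [← hx] at hi
      simp at hi
      have := mul_sinh_lt hy
      rw [hi] at this
      nlinarith
    · have h2x := Real.sin_lt (mul_pos two_pos hx)
      rw [Real.sin_two_mul] at h2x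
      nlinarith

lemma re_lt_pi {s : ℂ} (h : ‖-s ^ 2‖ - (-s ^ 2).re < 2 * Real.pi ^ 2) : s.re < Real.pi := by
  rw [norm_sub_re_neg_sq] at h
  exact lt_of_pow_lt_pow_left₀ 2 Real.pi_pos.le (by linarith)

lemma deriv_E_ne_zero {r : ℂ} (hr : ‖r‖ - r.re < 2 * Real.pi ^ 2) (hE : E r ≠ 0) :
    deriv E r ≠ 0 := by
  obtain ⟨s, hs, rfl⟩ := exists_neg_sq_eq r
  by_cases h0 : s = 0
  · subst h0
    simp [deriv_E_zero]
  intro hd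
  have h := E_add_deriv s
  rw [hd, mul_zero, sub_zero] at h
  refine sin_ne_mul_cos hs (re_lt_pi hr) h0 (h ▸ hE) ?_
  rw [← mul_E_neg_sq, h]

lemma eq_zero_of_E_eq_one {r : ℂ} (hr : ‖r‖ - r.re < 2 * Real.pi ^ 2) (hE : E r = 1) : r = 0 := by
  obtain ⟨s, hs, rfl⟩ := exists_neg_sq_eq r
  have := eq_zero_of_sin_eq_self hs (re_lt_pi hr) (by rw [← mul_E_neg_sq, hE, mul_one])
  simp [this]

/-- At `s = π + iy` the real part of `sin s / s` is `-y sinh y / |s|²`. The boundary of the region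
therefore misses the right half-plane, which is half of properness. -/
lemma E_re_nonpos {r : ℂ} (hr : ‖r‖ - r.re = 2 * Real.pi ^ 2) : (E r).re ≤ 0 := by
  obtain ⟨s, hs, rfl⟩ := exists_neg_sq_eq r
  rw [norm_sub_re_neg_sq] at hr
  have hx : s.re = Real.pi := by
    rw [← pow_left_inj₀ hs Real.pi_pos.le two_ne_zero]
    linarith
  have hs0 : s ≠ 0 := by
    rintro rfl
    exact Real.pi_ne_zero (by simpa using hx.symm)
  rw [E_neg_sq hs0, Complex.div_re, sin_re, sin_im, hx, Real.sin_pi, Real.cos_pi]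
  have h1 : 0 < Complex.normSq s := Complex.normSq_pos.2 hs0
  have h2 : 0 ≤ Real.sinh s.im * s.im := by
    rcases le_total 0 s.im with h | h
    · exact mul_nonneg (Real.sinh_nonneg_iff.2 h) h
    · exact mul_nonneg_of_nonpos_of_nonpos (Real.sinh_nonpos_iff.2 h) h
  have h3 := div_nonneg h2 h1.le
  have : 0 * Real.cosh s.im * Real.pi / normSq s + -1 * Real.sinh s.im * s.im / normSq s
      = -(Real.sinh s.im * s.im / normSq s) := by ring
  linarith

lemma sq_le_four_mul_abs_sinh (y : ℝ) : y ^ 2 ≤ 4 * |Real.sinh y| := by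
  wlog hy : 0 ≤ y generalizing y
  · simpa using this (-y) (by linarith)
  have h1 := Real.quadratic_le_exp_of_nonneg hy
  have h2 : Real.exp (-y) ≤ 1 := Real.exp_le_one_iff.2 (by linarith)
  have h3 := le_abs_self (Real.sinh y)
  rw [Real.sinh_eq] at h3 ⊢
  linarith

/-- The other half of properness: in the strip `|sinh (im s)| ≤ |sin s| ≤ M |s|`, and `sinh`
outgrows linear functions, so `im s` stays bounded. -/
lemma norm_le_of_norm_E_le {r : ℂ} {M : ℝ} (hr : ‖r‖ - r.re ≤ 2 * Real.pi ^ 2)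
    (hM : ‖E r‖ ≤ M) : ‖r‖ ≤ Real.pi ^ 2 + (Real.pi + 8 * M) ^ 2 := by
  obtain ⟨s, hs, rfl⟩ := exists_neg_sq_eq r
  rw [norm_sub_re_neg_sq] at hr
  have hM0 : 0 ≤ M := (norm_nonneg _).trans hM
  have hx : s.re ≤ Real.pi := pow_le_pow_iff_left₀ hs Real.pi_pos.le two_ne_zero |>.1 (by linarith)
  have h1 : ‖Complex.sin s‖ ≤ M * ‖s‖ := by
    rw [← mul_E_neg_sq, norm_mul, mul_comm]
    gcongr
  have h2 : |Real.sinh s.im| ≤ ‖Complex.sin s‖ := by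
    refine abs_le_of_sq_le_sq ?_ (norm_nonneg _)
    rw [← Complex.normSq_eq_norm_sq, Complex.normSq_apply, sin_re, sin_im]
    have p1 := Real.sin_sq_add_cos_sq s.re
    have p2 := Real.cosh_sq s.im
    nlinarith [sq_nonneg (Real.sin s.re)]
  have h3 : ‖s‖ ≤ Real.pi + |s.im| := by
    refine (Complex.norm_le_abs_re_add_abs_im s).trans ?_
    rw [abs_of_nonneg hs]
    gcongr
  have h4 := sq_le_four_mul_abs_sinh s.im
  -- Beyond this bound `4M(π + |y|) ≤ 8M|y| < y²`, contradicting the quadratic lower bound on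
  -- `sinh`.
  have h5 : |s.im| ≤ Real.pi + 8 * M := by
    by_contra hcon
    push Not at hcon
    have h6 : s.im ^ 2 ≤ 4 * (M * (Real.pi + |s.im|)) := by
      nlinarith [mul_le_mul_of_nonneg_left h3 hM0]
    rw [← sq_abs] at h6
    nlinarith [Real.pi_pos, abs_nonneg s.im]
  rw [norm_neg, norm_pow, ← Complex.normSq_eq_norm_sq, Complex.normSq_apply]
  have h7 : s.im * s.im ≤ (Real.pi + 8 * M) ^ 2 := by
    rw [← abs_mul_abs_self, ← pow_two]
    gcongr
  nlinarith

end ExpBM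

end

/-! ### Global inversion of proper local biholomorphisms. -/

section

open Filter Topology Set

/-- A proper, locally biholomorphic map from `V` to a connected open set `H` for which one point of
`H` has a unique preimage in `V` has a holomorphic inverse on `H`. -/
theorem exists_holomorphic_inverse {f : ℂ → ℂ} {V H : Set ℂ} (hf : Differentiable ℂ f)
    (hV : IsOpen V) (hH : IsOpen H) (hHc : IsPreconnected H) (hmaps : MapsTo f V H)
    (hd : ∀ z ∈ V, deriv f z ≠ 0)
    (hproper : ∀ K ⊆ H, IsCompact K → IsCompact (V ∩ f ⁻¹' K))
    {z₀ : ℂ} (hz₀ : z₀ ∈ V) (huniq : ∀ z ∈ V, f z = f z₀ → z = z₀) :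
    ∃ ψ : ℂ → ℂ, DifferentiableOn ℂ ψ H ∧ (∀ w ∈ H, ψ w ∈ V ∧ f (ψ w) = w) ∧
      ∀ z ∈ V, ψ (f z) = z := by
  have hstrict : ∀ z, HasStrictDerivAt f (deriv f z) z := fun z =>
    (hf.contDiff (n := 1)).contDiffAt.hasStrictDerivAt (by norm_num)
  have hnhds : ∀ z ∈ V, ∀ U ∈ 𝓝 z, f '' U ∈ 𝓝 (f z) := fun z hz U hU => by
    rw [← (hstrict z).map_nhds_eq (hd z hz)]
    exact image_mem_map hU
  have hcompact : ∀ w ∈ H, ∀ u : ℕ → ℂ, (∀ n, u n ∈ H) → Tendsto u atTop (𝓝 w) →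
      IsCompact (V ∩ f ⁻¹' insert w (range u)) := fun w hw u hu hlim =>
    hproper _ (insert_subset hw (range_subset_iff.2 hu)) hlim.isCompact_insert_range
  -- the points with at least one and with at least two preimages form clopen subsets of `H`
  have hsurj : H ⊆ f '' V := by
    refine hHc.subset_of_closure_inter_subset ?_ ⟨f z₀, hmaps hz₀, z₀, hz₀, rfl⟩ ?_
    · rw [isOpen_iff_mem_nhds]
      rintro _ ⟨z, hz, rfl⟩
      exact hnhds z hz V (hV.mem_nhds hz)
    · rintro w ⟨hw, hwH⟩
      obtain ⟨u, hu, hlim⟩ := mem_closure_iff_seq_limit.1 hw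
      choose z hz hzu using hu
      have hK := hcompact w hwH u (fun n => hzu n ▸ hmaps (hz n)) hlim
      obtain ⟨z', hz', φ, hφ, hzφ⟩ := hK.tendsto_subseq (x := z)
        fun n => ⟨hz n, by rw [mem_preimage, hzu]; exact Or.inr ⟨n, rfl⟩⟩
      refine ⟨z', hz'.1, tendsto_nhds_unique ((hf.continuous.tendsto z').comp hzφ) ?_⟩
      simpa [Function.comp_def, hzu] using hlim.comp hφ.tendsto_atTop
  have hinj : InjOn f V := by
    intro p hp q hq hpq
    by_contra hne
    set A : Set ℂ := {w | ∃ z₁ ∈ V, ∃ z₂ ∈ V, z₁ ≠ z₂ ∧ f z₁ = w ∧ f z₂ = w} with hA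
    have hsub : H ⊆ A := by
      refine hHc.subset_of_closure_inter_subset ?_
        ⟨f p, hmaps hp, p, hp, q, hq, hne, rfl, hpq.symm⟩ ?_
      · rw [isOpen_iff_mem_nhds]
        rintro w ⟨z₁, h₁, z₂, h₂, hz, rfl, hw⟩
        obtain ⟨U₁, U₂, ho₁, ho₂, hm₁, hm₂, hdisj⟩ := t2_separation hz
        filter_upwards [hnhds z₁ h₁ _ (inter_mem (ho₁.mem_nhds hm₁) (hV.mem_nhds h₁)),
          hw ▸ hnhds z₂ h₂ _ (inter_mem (ho₂.mem_nhds hm₂) (hV.mem_nhds h₂))]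
        rintro w ⟨a, ha, rfl⟩ ⟨b, hb, hab⟩
        refine ⟨a, ha.2, b, hb.2, ?_, rfl, hab⟩
        rintro rfl
        exact disjoint_left.1 hdisj ha.1 hb.1
      · rintro w ⟨hw, hwH⟩
        obtain ⟨u, hu, hlim⟩ := mem_closure_iff_seq_limit.1 hw
        choose a ha b hb hab hau hbu using hu
        have hK := hcompact w hwH u (fun n => hau n ▸ hmaps (ha n)) hlim
        obtain ⟨⟨a', b'⟩, hab', φ, hφ, habφ⟩ := (hK.prod hK).tendsto_subseq
          (x := fun n => (a n, b n)) fun n =>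
            ⟨⟨ha n, by rw [mem_preimage, hau]; exact Or.inr ⟨n, rfl⟩⟩,
              ⟨hb n, by rw [mem_preimage, hbu]; exact Or.inr ⟨n, rfl⟩⟩⟩
        have haφ : Tendsto (a ∘ φ) atTop (𝓝 a') := (continuous_fst.tendsto _).comp habφ
        have hbφ : Tendsto (b ∘ φ) atTop (𝓝 b') := (continuous_snd.tendsto _).comp habφ
        have hlim' := hlim.comp hφ.tendsto_atTop
        refine ⟨a', hab'.1.1, b', hab'.2.1, ?_,
          tendsto_nhds_unique ((hf.continuous.tendsto a').comp haφ)
            (by simpa [Function.comp_def, hau] using hlim'),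
          tendsto_nhds_unique ((hf.continuous.tendsto b').comp hbφ)
            (by simpa [Function.comp_def, hbu] using hlim')⟩
        -- If the two preimages merged in the limit, `f` would fail to be injective near `a'`.
        rintro rfl
        have hleft := ((hstrict a').hasStrictFDerivAt_equiv (hd a' hab'.1.1)).eventually_left_inverse
        obtain ⟨n, h₁, h₂⟩ := ((haφ.eventually hleft).and (hbφ.eventually hleft)).exists
        refine hab (φ n) ?_
        simp only [Function.comp_apply] at h₁ h₂
        rw [← h₁, ← h₂, hau, hbu]
    obtain ⟨z₁, h₁, z₂, h₂, hz, e₁, e₂⟩ := hsub (hmaps hz₀)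
    exact hz ((huniq z₁ h₁ e₁).trans (huniq z₂ h₂ e₂).symm)
  have hsurj' : ∀ w, ∃ z, w ∈ H → z ∈ V ∧ f z = w := fun w => by
    by_cases hw : w ∈ H
    · obtain ⟨z, hz⟩ := hsurj hw
      exact ⟨z, fun _ => hz⟩
    · exact ⟨0, fun h => absurd h hw⟩
  choose ψ hψ using hsurj'
  refine ⟨ψ, fun w hw => ?_, hψ,
    fun z hz => hinj (hψ _ (hmaps hz)).1 hz (hψ _ (hmaps hz)).2⟩
  have hcont : ContinuousAt ψ w := by
    intro U hU
    have h := hnhds _ (hψ w hw).1 _ (inter_mem hU (hV.mem_nhds (hψ w hw).1))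
    rw [(hψ w hw).2] at h
    refine mem_map.2 (mem_of_superset h ?_)
    rintro _ ⟨z, ⟨hzU, hzV⟩, rfl⟩
    rwa [mem_preimage, hinj (hψ _ (hmaps hzV)).1 hzV (hψ _ (hmaps hzV)).2]
  exact (HasStrictDerivAt.of_local_left_inverse hcont (hstrict (ψ w)) (hd _ (hψ w hw).1) (by
    filter_upwards [hH.mem_nhds hw] with w' hw'
      using (hψ w' hw').2)).hasDerivAt.differentiableAt.differentiableWithinAt

end

/-! ### The inverse of `g`, branch-free formulas for `G`, and the extension of `F`. -/

section

open Filter Topology Set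

namespace ExpBM

/-- The branch of the inverse of `E` on the right half-plane that extends `gInv`. -/
lemma exists_inverse_E : ∃ ψ : ℂ → ℂ, DifferentiableOn ℂ ψ {w | 0 < w.re} ∧
    ∀ r : ℂ, ‖r‖ - r.re < 2 * Real.pi ^ 2 → 0 < (E r).re → ψ (E r) = r := by
  have hP : Continuous fun r : ℂ => ‖r‖ - r.re := by fun_prop
  have hE : Continuous fun r : ℂ => (E r).re := Complex.continuous_re.comp differentiable_E.continuous
  obtain ⟨ψ, h1, -, h3⟩ := exists_holomorphic_inverse (f := E)
    (V := {r | ‖r‖ - r.re < 2 * Real.pi ^ 2 ∧ 0 < (E r).re}) (H := {w | 0 < w.re}) (z₀ := 0)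
    differentiable_E ((isOpen_lt hP continuous_const).inter (isOpen_lt continuous_const hE))
    (isOpen_lt continuous_const Complex.continuous_re) (convex_halfSpace_re_gt 0).isPreconnected
    (fun r hr => hr.2)
    (fun r hr => deriv_E_ne_zero hr.1 (fun h => by simpa [h] using hr.2))
    (fun K hK hKc => by
      obtain ⟨M, hM⟩ := hKc.isBounded.exists_norm_le
      -- Closing the parabolic region adds no point, since its boundary is not mapped into `K`; the
      -- preimage of `K` is thus closed.
      have : {r | ‖r‖ - r.re < 2 * Real.pi ^ 2 ∧ 0 < (E r).re} ∩ E ⁻¹' K =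
          {r | ‖r‖ - r.re ≤ 2 * Real.pi ^ 2} ∩ E ⁻¹' K := by
        ext r
        refine ⟨fun h => ⟨h.1.1.le, h.2⟩, fun h => ⟨⟨lt_of_le_of_ne h.1 fun h' => ?_, hK h.2⟩, h.2⟩⟩
        exact (E_re_nonpos h').not_gt (hK h.2)
      rw [this]
      refine Metric.isCompact_of_isClosed_isBounded
        ((isClosed_le hP continuous_const).inter (hKc.isClosed.preimage differentiable_E.continuous))
        (isBounded_iff_forall_norm_le.2 ⟨_, fun r hr => norm_le_of_norm_E_le hr.1 (hM _ hr.2)⟩))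
    ⟨by simp [Real.pi_pos], by simp [E_zero]⟩
    (fun r hr h => eq_zero_of_E_eq_one hr.1 (h.trans E_zero))
  exact ⟨ψ, h1, fun r hr hr' => h3 r ⟨hr, hr'⟩⟩

lemma E_ofReal (r : ℝ) : E r = g r := by
  rw [g]
  split_ifs with h0 h1
  · have hs := Real.sqrt_pos.2 h0
    have hc : ((Real.sqrt r : ℝ) : ℂ) ≠ 0 := by exact_mod_cast hs.ne'
    push_cast
    rw [eq_div_iff hc, mul_comm, ← mul_E_sq, ← Complex.ofReal_pow, Real.sq_sqrt h0.le]
  · simp [h1, E_zero]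
  · have h2 : 0 < -r := by
      rcases lt_trichotomy r 0 with h | h | h
      · linarith
      · exact absurd h h1
      · exact absurd h h0
    have hs := Real.sqrt_pos.2 h2
    have hc : ((Real.sqrt (-r) : ℝ) : ℂ) ≠ 0 := by exact_mod_cast hs.ne'
    push_cast
    rw [eq_div_iff hc, mul_comm, ← mul_E_neg_sq, ← Complex.ofReal_pow, Real.sq_sqrt h2.le]
    simp

lemma continuous_g : Continuous g := by
  have : g = fun r : ℝ => (E r).re := by
    ext r
    rw [E_ofReal, Complex.ofReal_re]
  rw [this]
  exact Complex.continuous_re.comp (differentiable_E.continuous.comp Complex.continuous_ofReal)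

lemma g_neg_sq {s : ℝ} (hs : 0 < s) : g (-s ^ 2) = Real.sin s / s := by
  rw [g, if_neg (by nlinarith), if_neg (by nlinarith), neg_neg, Real.sqrt_sq hs.le]

lemma g_sq {s : ℝ} (hs : 0 < s) : g (s ^ 2) = Real.sinh s / s := by
  rw [g, if_pos (by positivity), Real.sqrt_sq hs.le]

/-- Values below `2` suffice: they are the numbers `η⁻¹` with `η > 1 / 2`, or `1 - ξ` with `|ξ| <
1`. The endpoint `9 ^ 2` works because `sinh 9 ≥ 81 / 4 ≥ 18`. -/
lemma exists_g_eq {w : ℝ} (h0 : 0 < w) (h2 : w < 2) : ∃ r ∈ Ioi (-(Real.pi ^ 2)), g r = w := by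
  have hpi : g (-Real.pi ^ 2) = 0 := by simp [g_neg_sq Real.pi_pos]
  have h9 : 2 ≤ g (9 ^ 2) := by
    rw [g_sq (by norm_num), le_div_iff₀ (by norm_num)]
    have := sq_le_four_mul_abs_sinh 9
    rw [abs_of_pos (Real.sinh_pos_iff.2 (by norm_num))] at this
    linarith
  obtain ⟨r, hr, hrw⟩ := intermediate_value_Icc (a := -Real.pi ^ 2) (b := 9 ^ 2)
    (by nlinarith [Real.pi_pos]) continuous_g.continuousOn (show w ∈ Icc _ _ from
      ⟨by rw [hpi]; exact h0.le, h2.le.trans h9⟩)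
  refine ⟨r, lt_of_le_of_ne hr.1 ?_, hrw⟩
  rintro h
  rw [← h, hpi] at hrw
  exact h0.ne hrw

lemma gInv_mem {w : ℝ} (h0 : 0 < w) (h2 : w < 2) : -(Real.pi ^ 2) < gInv w :=
  Function.invFunOn_mem (exists_g_eq h0 h2)

lemma g_gInv {w : ℝ} (h0 : 0 < w) (h2 : w < 2) : g (gInv w) = w :=
  Function.invFunOn_eq (exists_g_eq h0 h2)

/-- For `η > 1`, `η = s / sin s` with `s ∈ (0, π)`, and `G η` in terms of `s`. -/
lemma exists_G_eq_of_one_lt {η : ℝ} (h : 1 < η) : ∃ s : ℝ, 0 < s ∧ s < Real.pi ∧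
    η * Real.sin s = s ∧ gInv η⁻¹ = -s ^ 2 ∧ G η = 2 * η * (1 - Real.cos s) - s ^ 2 := by
  have h0 : 0 < η := by linarith
  have hw : η⁻¹ < 1 := inv_lt_one_of_one_lt₀ h
  have hm := gInv_mem (inv_pos.2 h0) (by linarith)
  have he := g_gInv (inv_pos.2 h0) (by linarith)
  have hneg : gInv η⁻¹ < 0 := by
    by_contra hcon
    push Not at hcon
    have : 1 ≤ g (gInv η⁻¹) := by
      rcases hcon.eq_or_lt with h | h
      · simp [← h, g]
      · rw [← Real.sq_sqrt hcon, g_sq (Real.sqrt_pos.2 h), le_div_iff₀ (Real.sqrt_pos.2 h), one_mul]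
        exact Real.self_le_sinh_iff.2 (Real.sqrt_nonneg _)
    linarith
  set s := Real.sqrt (-gInv η⁻¹) with hs
  have hs0 : 0 < s := Real.sqrt_pos.2 (by linarith)
  have hs2 : gInv η⁻¹ = -s ^ 2 := by rw [hs, Real.sq_sqrt (by linarith), neg_neg]
  have hpi : s < Real.pi := lt_of_pow_lt_pow_left₀ 2 Real.pi_pos.le (by linarith)
  rw [hs2, g_neg_sq hs0] at he
  have hη : η * Real.sin s = s := by
    field_simp at he
    linarith
  refine ⟨s, hs0, hpi, hη, hs2, ?_⟩
  rw [G, hs2]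
  have hsq : η ^ 2 + -s ^ 2 = (η * Real.cos s) ^ 2 := by
    have := Real.sin_sq_add_cos_sq s
    linear_combination η ^ 2 * (-this) + (s + η * Real.sin s) * hη
  -- The sign factor is the sign of `π² - 4s²`, hence of `cos s`; it undoes the absolute value in
  -- the square root.
  have hkey : Real.sign (4 * -s ^ 2 + Real.pi ^ 2) * Real.sqrt (η ^ 2 + -s ^ 2) = η * Real.cos s := by
    rw [hsq, Real.sqrt_sq_eq_abs, abs_mul, abs_of_pos h0]
    rcases lt_trichotomy s (Real.pi / 2) with h | h | h
    · rw [Real.sign_of_pos (by nlinarith), abs_of_pos (Real.cos_pos_of_mem_Ioo ⟨by linarith, h⟩)]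
      ring
    · rw [h, Real.cos_pi_div_two]
      simp
    · rw [Real.sign_of_neg (by nlinarith),
        abs_of_neg (Real.cos_neg_of_pi_div_two_lt_of_lt h (by linarith))]
      ring
  linear_combination (-2) * hkey

/-- A formula for `G` without branches. -/
lemma G_eq {η : ℝ} (h : 1 / 2 < η) :
    G η = gInv η⁻¹ - η * (gInv η⁻¹ * g (gInv η⁻¹ / 4) ^ 2) := by
  have h0 : 0 < η := by linarith
  -- On both sides the half-angle formula for `1 - cos s` or `cosh s - 1` produces `g (r / 4) ^ 2`.
  rcases lt_or_ge 1 η with h1 | h1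
  · obtain ⟨s, hs0, hpi, hη, hr, hG⟩ := exists_G_eq_of_one_lt h1
    rw [hG, hr, show -s ^ 2 / 4 = -(s / 2) ^ 2 by ring, g_neg_sq (by linarith),
      show Real.cos s = 1 - 2 * Real.sin (s / 2) ^ 2 by
        nth_rw 1 [show s = 2 * (s / 2) by ring]
        rw [Real.cos_two_mul, Real.cos_sq']
        ring]
    field_simp
    ring
  · have hw : η⁻¹ < 2 := by
      rw [inv_lt_comm₀ h0 two_pos]
      linarith
    have hm := gInv_mem (inv_pos.2 h0) hw
    have he := g_gInv (inv_pos.2 h0) hw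
    have hw1 : 1 ≤ η⁻¹ := (one_le_inv₀ h0).2 h1
    have hnn : 0 ≤ gInv η⁻¹ := by
      by_contra hcon
      push Not at hcon
      set s := Real.sqrt (-gInv η⁻¹) with hs
      have hs0 : 0 < s := Real.sqrt_pos.2 (by linarith)
      have hs2 : gInv η⁻¹ = -s ^ 2 := by rw [hs, Real.sq_sqrt (by linarith), neg_neg]
      rw [hs2, g_neg_sq hs0] at he
      have : Real.sin s / s < 1 := (div_lt_one hs0).2 (Real.sin_lt hs0)
      linarith
    rw [G, Real.sign_of_pos (by nlinarith [Real.pi_pos])]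
    rcases hnn.eq_or_lt with h0' | hpos
    · rw [← h0']
      simp [Real.sqrt_sq h0.le]
    set s := Real.sqrt (gInv η⁻¹) with hs
    have hs0 : 0 < s := Real.sqrt_pos.2 hpos
    have hs2 : gInv η⁻¹ = s ^ 2 := by rw [hs, Real.sq_sqrt hnn]
    rw [hs2, g_sq hs0] at he
    have hη : η * Real.sinh s = s := by
      field_simp at he
      linarith
    rw [hs2, show s ^ 2 / 4 = (s / 2) ^ 2 by ring, g_sq (by linarith)]
    have hsq : η ^ 2 + s ^ 2 = (η * Real.cosh s) ^ 2 := by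
      have := Real.cosh_sq s
      linear_combination η ^ 2 * (-this) - (s + η * Real.sinh s) * hη
    rw [hsq, Real.sqrt_sq (by positivity)]
    have hc : Real.cosh s = 1 + 2 * Real.sinh (s / 2) ^ 2 := by
      nth_rw 1 [show s = 2 * (s / 2) by ring]
      rw [Real.cosh_two_mul, Real.cosh_sq]
      ring
    rw [hc]
    field_simp
    ring

/-- The function `ξ ↦ (1 - ξ) G (1 / (1 - ξ))` extends holomorphically to the unit disc, and the
extension vanishes to second order at `0`. -/
theorem exists_holomorphic_extension : ∃ F : ℂ → ℂ, DifferentiableOn ℂ F (Metric.ball (0 : ℂ) 1) ∧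
    F 0 = 0 ∧ deriv F 0 = 0 ∧
    ∀ ξ : ℝ, |ξ| < 1 → F (ξ : ℂ) = (((1 - ξ) * G (1 / (1 - ξ)) : ℝ) : ℂ) := by
  obtain ⟨ψ, hψ, hinv⟩ := exists_inverse_E
  have hmaps : MapsTo (fun ξ : ℂ => 1 - ξ) (Metric.ball (0 : ℂ) 1) {w | 0 < w.re} := by
    intro ξ hξ
    have h1 := (Complex.abs_re_le_norm ξ).trans_lt (mem_ball_zero_iff.1 hξ)
    have h2 := (abs_lt.1 h1).2
    simpa using h2
  have hcomp : DifferentiableOn ℂ (fun ξ => ψ (1 - ξ)) (Metric.ball (0 : ℂ) 1) :=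
    hψ.comp (by fun_prop) hmaps
  have h4 : DifferentiableOn ℂ (fun ξ => E (ψ (1 - ξ) / 4)) (Metric.ball (0 : ℂ) 1) :=
    differentiable_E.comp_differentiableOn (hcomp.div_const 4)
  have h5 : DifferentiableOn ℂ (fun ξ => (1 - ξ) - E (ψ (1 - ξ) / 4) ^ 2)
      (Metric.ball (0 : ℂ) 1) :=
    (by fun_prop : DifferentiableOn ℂ (fun ξ : ℂ => 1 - ξ) (Metric.ball (0 : ℂ) 1)).sub (h4.pow 2)
  have hψ1 : ψ 1 = 0 := by
    have := hinv 0 (by simp [Real.pi_pos]) (by simp [E_zero])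
    rwa [E_zero] at this
  have hball : Metric.ball (0 : ℂ) 1 ∈ 𝓝 0 := Metric.ball_mem_nhds _ one_pos
  -- This is `G_eq` multiplied by `1 - ξ = η⁻¹`, with `r = ψ (1 - ξ)`. Both factors vanish at `ξ =
  -- 0`, whence the double zero.
  refine ⟨fun ξ => ψ (1 - ξ) * ((1 - ξ) - E (ψ (1 - ξ) / 4) ^ 2), hcomp.mul h5, ?_, ?_,
    fun ξ hξ => ?_⟩
  · simp [hψ1]
  · have h := (hcomp.differentiableAt hball).hasDerivAt.mul
      (h5.differentiableAt hball).hasDerivAt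
    have h' := h.deriv
    simp only [sub_zero, hψ1, zero_div, E_zero, one_pow, sub_self, mul_zero, zero_mul,
      add_zero] at h'
    exact h'
  · obtain ⟨hξ1, hξ2⟩ := abs_lt.1 hξ
    have hw0 : 0 < 1 - ξ := by linarith
    have hm := gInv_mem hw0 (by linarith)
    have he := g_gInv hw0 (by linarith)
    have hr : ψ (1 - ξ) = gInv (1 - ξ) := by
      have := hinv (gInv (1 - ξ)) (by
        rw [Complex.norm_real, Complex.ofReal_re, Real.norm_eq_abs]
        rcases abs_cases (gInv (1 - ξ)) with h | h <;> nlinarith [Real.pi_pos])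
        (by rw [E_ofReal, he]; exact hw0)
      rw [E_ofReal, he] at this
      exact_mod_cast this
    rw [G_eq (by rw [lt_div_iff₀ hw0]; linarith)]
    simp only [hr]
    rw [show ((gInv (1 - ξ) : ℂ) / 4) = ((gInv (1 - ξ) / 4 : ℝ) : ℂ) by push_cast; rfl, E_ofReal]
    rw [one_div, inv_inv]
    push_cast
    have hc : (1 - ξ : ℂ) ≠ 0 := by exact_mod_cast hw0.ne'
    field_simp

end ExpBM

end

/-! ### Taylor remainders and gluing of one-sided expansions. -/

section

open Filter Topology Set

/-- Taylor's formula with a remainder that is analytic, from the iterated slopes. -/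
lemma HasFPowerSeriesAt.exists_eq_sum_add {𝕜 : Type*} [NontriviallyNormedField 𝕜] {f : 𝕜 → 𝕜}
    {p : FormalMultilinearSeries 𝕜 𝕜 𝕜} (hp : HasFPowerSeriesAt f p 0) (n : ℕ) :
    ∃ u : 𝕜 → 𝕜, AnalyticAt 𝕜 u 0 ∧
      ∀ x, f x = ∑ k ∈ Finset.range n, p.coeff k * x ^ k + x ^ n * u x := by
  induction n generalizing f p with
  | zero => exact ⟨f, hp.analyticAt, fun x => by simp⟩
  | succ n ih =>
    obtain ⟨u, hu, hfu⟩ := ih hp.has_fpower_series_dslope_fslope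
    refine ⟨u, hu, fun x => ?_⟩
    have h := sub_smul_dslope f 0 x
    rw [sub_zero, smul_eq_mul, hfu x] at h
    have h0 : p.coeff 0 = f 0 := hp.coeff_zero 1
    rw [Finset.sum_range_succ', pow_zero, mul_one, h0, eq_add_of_sub_eq h.symm, mul_add,
      Finset.mul_sum]
    simp only [FormalMultilinearSeries.coeff_fslope, pow_succ']
    rw [Finset.sum_congr rfl fun k _ => mul_left_comm x (p.coeff (k + 1)) (x ^ k)]
    ring

lemma ContDiffAt.continuousAt_iteratedDeriv {f : ℝ → ℝ} {c : ℝ} {n : ℕ}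
    (hf : ContDiffAt ℝ n f c) : ContinuousAt (iteratedDeriv n f) c := by
  have h : ContDiffAt ℝ 0 (iteratedFDeriv ℝ n f) c := hf.iteratedFDeriv_right (by simp)
  exact (continuous_eval_const (fun _ : Fin n => (1 : ℝ))).continuousAt.comp h.continuousAt

/-- The `n`-th derivative of a `C^n` function is determined by the function on an open set that
accumulates at the point. -/
lemma iteratedDeriv_eq_of_eventuallyEq_nhdsWithin {f g : ℝ → ℝ} {c : ℝ} {n : ℕ} {s : Set ℝ}
    [(𝓝[s] c).NeBot] (hs : IsOpen s) (hf : ContDiffAt ℝ n f c) (hg : ContDiffAt ℝ n g c)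
    (h : f =ᶠ[𝓝[s] c] g) : iteratedDeriv n f c = iteratedDeriv n g c := by
  refine tendsto_nhds_unique (l := 𝓝[s] c) (hf.continuousAt_iteratedDeriv.tendsto.mono_left nhdsWithin_le_nhds)
    ((hg.continuousAt_iteratedDeriv.tendsto.mono_left nhdsWithin_le_nhds).congr' ?_)
  filter_upwards [eventually_eventually_nhdsWithin.2 h, self_mem_nhdsWithin] with x hx hxs
  rw [hs.nhdsWithin_eq hxs] at hx
  exact (EventuallyEq.iteratedDeriv_eq n hx).symm

lemma contDiff_max_zero_pow (n : ℕ) : ContDiff ℝ n (fun x : ℝ => max x 0 ^ (n + 1)) := by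
  induction n with
  | zero => exact contDiff_zero.2 (by fun_prop)
  | succ n ih =>
    have hd : ∀ x : ℝ, HasDerivAt (fun x : ℝ => max x 0 ^ (n + 1 + 1))
        ((n + 2) * max x 0 ^ (n + 1)) x := by
      refine hasDerivAt_of_hasDerivAt_of_ne' (x := 0) (fun y hy => ?_)
        (by fun_prop) (by fun_prop)
      rcases lt_or_gt_of_ne hy with hy | hy
      · rw [max_eq_right hy.le, zero_pow (by simp), mul_zero]
        refine (hasDerivAt_const y (0 : ℝ)).congr_of_eventuallyEq ?_
        filter_upwards [Iio_mem_nhds hy] with z (hz : z < 0)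
        simp [hz.le]
      · rw [max_eq_left hy.le]
        have h := hasDerivAt_pow (n + 1 + 1) y
        push_cast at h
        rw [show (n : ℝ) + 1 + 1 = n + 2 by ring] at h
        refine h.congr_of_eventuallyEq ?_
        filter_upwards [Ioi_mem_nhds hy] with z (hz : 0 < z)
        simp [hz.le]
    rw [Nat.cast_add_one, contDiff_succ_iff_deriv]
    refine ⟨fun x => (hd x).differentiableAt, by simp, ?_⟩
    rw [funext fun x => (hd x).deriv]
    exact contDiff_const.mul ih

/-- A function that is of the form `(x - c) ^ (n + 1)` times a `C^n` function on both sides of `c`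
is `C^n` at `c`, with vanishing `n`-th derivative. -/
lemma contDiffAt_of_eventually_eq_pow_mul {D U V : ℝ → ℝ} {c : ℝ} {n : ℕ}
    (hU : ContDiffAt ℝ n U c) (hV : ContDiffAt ℝ n V c) (hc : D c = 0)
    (hgt : ∀ᶠ x in 𝓝[>] c, D x = (x - c) ^ (n + 1) * U x)
    (hlt : ∀ᶠ x in 𝓝[<] c, D x = (x - c) ^ (n + 1) * V x) :
    ContDiffAt ℝ n D c ∧ iteratedDeriv n D c = 0 := by
  have hw : ContDiffAt ℝ n (fun x : ℝ => max (x - c) 0 ^ (n + 1)) c :=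
    ((contDiff_max_zero_pow n).comp (contDiff_id.sub contDiff_const)).contDiffAt
  have hp : ContDiffAt ℝ n (fun x : ℝ => (x - c) ^ (n + 1)) c := by fun_prop
  have h1 := hw.mul hU
  have h2 := (hp.sub hw).mul hV
  -- The truncated power `max (x - c) 0 ^ (n + 1)` glues the two sides. Each summand vanishes
  -- identically on one side of `c`, so its `n`-th derivative at `c` is zero.
  have hD : D =ᶠ[𝓝 c] ((fun x => max (x - c) 0 ^ (n + 1) * U x) +
      fun x => ((x - c) ^ (n + 1) - max (x - c) 0 ^ (n + 1)) * V x) := by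
    rw [eventually_nhdsWithin_iff] at hgt hlt
    filter_upwards [hgt, hlt] with x hx1 hx2
    rcases lt_trichotomy x c with h | rfl | h
    · simp [hx2 h, max_eq_right (sub_nonpos.2 h.le)]
    · simp [hc]
    · simp [hx1 h, max_eq_left (sub_nonneg.2 h.le)]
  refine ⟨(h1.add h2).congr_of_eventuallyEq hD, ?_⟩
  rw [hD.iteratedDeriv_eq, iteratedDeriv_add h1 h2,
    iteratedDeriv_eq_of_eventuallyEq_nhdsWithin (g := fun _ => 0) (s := Iio c) isOpen_Iio h1
      contDiffAt_const ?_,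
    iteratedDeriv_eq_of_eventuallyEq_nhdsWithin (g := fun _ => 0) (s := Ioi c) isOpen_Ioi h2
      contDiffAt_const ?_]
  · simp
  · filter_upwards [self_mem_nhdsWithin] with x (hx : c < x)
    simp [hx.le]
  · filter_upwards [self_mem_nhdsWithin] with x (hx : x < c)
    simp [hx.le]

/-- In the Leibniz formula only the term with all `n` derivatives on the power survives at `c`. -/
lemma iteratedDeriv_sub_pow_mul {u : ℝ → ℝ} {c : ℝ} {n : ℕ} (hu : ContDiffAt ℝ n u c) :
    iteratedDeriv n (fun x => (x - c) ^ n * u x) c = n.factorial * u c := by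
  rw [iteratedDeriv_fun_mul (by fun_prop) hu, Finset.sum_eq_single_of_mem n (by simp)]
  · simp [iteratedDeriv_comp_sub_const n (fun x : ℝ => x ^ n), Nat.descFactorial_self]
  · intro k hk hkn
    have : n - k ≠ 0 := by
      have := Finset.mem_range.1 hk
      omega
    simp [iteratedDeriv_comp_sub_const k (fun x : ℝ => x ^ n), this]

end

/-! ### Existence, uniqueness and convergence of the coefficients. -/

section

open Filter Topology Set

namespace ExpBM

lemma GSum_of_one_lt (a b : ℕ → ℝ) (N : ℕ) {η : ℝ} (h : 1 < η) :
    GSum a b N η = ∑ k ∈ Finset.Icc 2 N, a k * ((η - 1) ^ k / η ^ (k - 1)) := by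
  refine Finset.sum_congr rfl fun k _ => ?_
  rw [GTerm, indicator_of_mem (show η ∈ Ioi 1 from h),
    indicator_of_notMem (fun h' : η ∈ Ioo 0 1 => h'.2.not_gt h), mul_zero, add_zero]

lemma GSum_of_lt_one (a b : ℕ → ℝ) (N : ℕ) {η : ℝ} (h0 : 0 < η) (h : η < 1) :
    GSum a b N η = ∑ k ∈ Finset.Icc 2 N,
      b k * ((-Real.log η) ^ k / (1 - Real.log η) ^ (k - 2)) := by
  refine Finset.sum_congr rfl fun k _ => ?_
  rw [GTerm, indicator_of_mem (show η ∈ Ioo 0 1 from ⟨h0, h⟩),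
    indicator_of_notMem (fun h' : η ∈ Ioi 1 => h.not_gt h'), mul_zero, zero_add]

lemma GSum_one (a b : ℕ → ℝ) (N : ℕ) : GSum a b N 1 = 0 :=
  Finset.sum_eq_zero fun k _ => by simp [GTerm]

lemma sum_range_succ_eq_sum_Icc {f : ℕ → ℝ} (h0 : f 0 = 0) (h1 : f 1 = 0) (n : ℕ) :
    ∑ k ∈ Finset.range (n + 1), f k = ∑ k ∈ Finset.Icc 2 n, f k := by
  refine (Finset.sum_subset (fun k hk => ?_) fun k hk hk' => ?_).symm
  · simp only [Finset.mem_Icc] at hk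
    exact Finset.mem_range.2 (by omega)
  · simp only [Finset.mem_Icc, Finset.mem_range] at hk hk'
    have : k = 0 ∨ k = 1 := by omega
    rcases this with rfl | rfl <;> assumption

lemma mul_one_sub_one_div_pow {η : ℝ} (h : 0 < η) {k : ℕ} (hk : 2 ≤ k) :
    η * (1 - 1 / η) ^ k = (η - 1) ^ k / η ^ (k - 1) := by
  obtain ⟨m, rfl⟩ : ∃ m, k = m + 1 := ⟨k - 1, by omega⟩
  rw [one_sub_div h.ne', div_pow, Nat.add_sub_cancel, pow_succ η]
  field_simp

/-- The expansion of `G` in the functions `(η - 1) ^ k / η ^ (k - 1)`. -/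
lemma exists_expansion_sub_one : ∃ a : ℕ → ℝ,
    (∀ n : ℕ, ∃ U : ℝ → ℝ, AnalyticAt ℝ U 1 ∧ ∀ η : ℝ, 1 / 2 < η →
      G η = ∑ k ∈ Finset.Icc 2 n, a k * ((η - 1) ^ k / η ^ (k - 1)) + (η - 1) ^ (n + 1) * U η) ∧
    ∀ η : ℝ, 1 < η → Tendsto
      (fun N => ∑ k ∈ Finset.Icc 2 N, a k * ((η - 1) ^ k / η ^ (k - 1))) atTop (𝓝 (G η)) := by
  obtain ⟨F, hF, hF0, hF1, hFG⟩ := exists_holomorphic_extension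
  set c : ℕ → ℂ := fun n => iteratedDeriv n F 0 / n.factorial with hc
  have hball : Metric.ball (0 : ℂ) 1 ∈ 𝓝 0 := Metric.ball_mem_nhds _ one_pos
  have hp := (hF.analyticAt hball).hasFPowerSeriesAt
  have hc0 : c 0 = 0 := by simp [hc, hF0]
  have hc1 : c 1 = 0 := by simp [hc, hF1]
  have hG : ∀ η : ℝ, 1 / 2 < η → |1 - 1 / η| < 1 ∧ G η = η * (F ((1 - 1 / η : ℝ) : ℂ)).re := by
    intro η hη
    have h0 : 0 < η := by linarith
    have h1 : |1 - 1 / η| < 1 := by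
      have h2 : 1 / η < 2 := by rw [div_lt_iff₀ h0]; linarith
      have h3 : 0 < 1 / η := by positivity
      rw [abs_lt]
      constructor <;> linarith
    refine ⟨h1, ?_⟩
    rw [hFG _ h1, Complex.ofReal_re, sub_sub_cancel, one_div_one_div, ← mul_assoc,
      mul_one_div_cancel h0.ne', one_mul]
  have hsum : ∀ (η : ℝ) (n : ℕ), 0 < η →
      η * (∑ k ∈ Finset.range (n + 1), c k * ((1 - 1 / η : ℝ) : ℂ) ^ k).re =
      ∑ k ∈ Finset.Icc 2 n, (c k).re * ((η - 1) ^ k / η ^ (k - 1)) := by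
    intro η n hη
    rw [Complex.re_sum, sum_range_succ_eq_sum_Icc (by simp [hc0]) (by simp [hc1]), Finset.mul_sum]
    refine Finset.sum_congr rfl fun k hk => ?_
    rw [← mul_one_sub_one_div_pow hη (Finset.mem_Icc.1 hk).1, ← Complex.ofReal_pow,
      Complex.re_mul_ofReal]
    ring
  -- `F` is real on `(-1, 1)`, so real parts of its Taylor coefficients give the expansion without
  -- first proving them real.
  refine ⟨fun n => (c n).re, fun n => ?_, fun η hη => ?_⟩
  · obtain ⟨u, hu, hFu⟩ := hp.exists_eq_sum_add (n + 1)
    simp only [FormalMultilinearSeries.coeff_ofScalars] at hFu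
    have hre : AnalyticAt ℝ (fun x : ℝ => (u (x : ℂ)).re) 0 := by
      have h1 : AnalyticAt ℝ u ((0 : ℝ) : ℂ) := by
        rw [Complex.ofReal_zero]
        exact hu.restrictScalars
      exact (Complex.reCLM.analyticAt _).comp (h1.comp (Complex.ofRealCLM.analyticAt 0))
    have hinv : AnalyticAt ℝ (fun η : ℝ => 1 / η) 1 :=
      analyticAt_const.div analyticAt_id one_ne_zero
    have hcomp : AnalyticAt ℝ (fun η : ℝ => (u ((1 - 1 / η : ℝ) : ℂ)).re) 1 := by
      refine AnalyticAt.fun_comp (g := fun x : ℝ => (u (x : ℂ)).re) ?_ (analyticAt_const.sub hinv)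
      simpa using hre
    refine ⟨fun η => η * (1 / η) ^ (n + 1) * (u ((1 - 1 / η : ℝ) : ℂ)).re,
      (analyticAt_id.mul (hinv.pow _)).mul hcomp, fun η hη => ?_⟩
    have h0 : 0 < η := by linarith
    rw [(hG η hη).2, hFu, Complex.add_re, mul_add, hsum η n h0, ← Complex.ofReal_pow,
      Complex.re_ofReal_mul, ← mul_assoc]
    have h2 : (1 - 1 / η) ^ (n + 1) = (η - 1) ^ (n + 1) * (1 / η) ^ (n + 1) := by
      rw [one_sub_div h0.ne', div_eq_mul_one_div, mul_pow]
    rw [h2]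
    ring
  · have h0 : 0 < η := by linarith
    obtain ⟨h1, h2⟩ := hG η (by linarith)
    -- For `η > 1` the point `1 - 1 / η` lies in `(0, 1)`, inside the disc of holomorphy.
    have hs := Complex.hasSum_taylorSeries_on_ball hF
      (z := ((1 - 1 / η : ℝ) : ℂ)) (by simpa [← Complex.ofReal_one, ← Complex.ofReal_inv, ← Complex.ofReal_sub, Complex.norm_real] using h1)
    have ht := (hs.tendsto_sum_nat.comp (tendsto_add_atTop_nat 1))
    have ht' := ((Complex.continuous_re.tendsto _).comp ht).const_mul η
    rw [h2]
    refine ht'.congr fun N => ?_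
    rw [← hsum η N h0]
    simp only [Function.comp_apply, sub_zero, smul_eq_mul, hc]
    congr 2
    refine Finset.sum_congr rfl fun k _ => ?_
    rw [div_eq_mul_inv]
    ring

/-- The case `n = 1` of the expansion, where the sum over `Icc 2 1` is empty. -/
lemma G_vanishes : AnalyticAt ℝ G 1 ∧ G 1 = 0 ∧ HasDerivAt G 0 1 := by
  obtain ⟨a, ha, -⟩ := exists_expansion_sub_one
  obtain ⟨U, hU, hGU⟩ := ha 1
  have hG : G =ᶠ[𝓝 1] fun η => (η - 1) ^ 2 * U η := by
    filter_upwards [Ioi_mem_nhds (show (1 / 2 : ℝ) < 1 by norm_num)] with η hη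
    simpa using hGU η hη
  have hA : AnalyticAt ℝ (fun η => (η - 1) ^ 2 * U η) 1 :=
    ((analyticAt_id.sub analyticAt_const).pow 2).mul hU
  refine ⟨hA.congr hG.symm, by simpa using hG.eq_of_nhds, ?_⟩
  have h := (((hasDerivAt_id (1 : ℝ)).sub_const 1).pow 2).mul hU.differentiableAt.hasDerivAt
  simp at h
  exact h.congr_of_eventuallyEq hG

lemma analyticAt_dslope_log : AnalyticAt ℝ (dslope Real.log 1) 1 :=
  (analyticAt_log one_pos).hasFPowerSeriesAt.has_fpower_series_dslope_fslope.analyticAt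

lemma log_eq (η : ℝ) : Real.log η = (η - 1) * dslope Real.log 1 η := by
  have := sub_smul_dslope Real.log 1 η
  simpa using this.symm

/-- The expansion of `G` in the functions `(-log η) ^ k / (1 - log η) ^ (k - 2)`. -/
lemma exists_expansion_log : ∃ b : ℕ → ℝ,
    ∀ n : ℕ, ∃ V : ℝ → ℝ, AnalyticAt ℝ V 1 ∧ ∀ η : ℝ, 0 < η → η < 1 →
      G η = ∑ k ∈ Finset.Icc 2 n, b k * ((-Real.log η) ^ k / (1 - Real.log η) ^ (k - 2)) +
        (η - 1) ^ (n + 1) * V η := by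
  obtain ⟨hGa, hG0, hG1⟩ := G_vanishes
  -- `e` inverts `ζ = -log η / (1 - log η)`. Since `1 - ζ = 1 / (1 - log η)`, the factor `(1 - ζ) ^
  -- 2` in `f` accounts for the exponent `k - 2`.
  set e : ℝ → ℝ := fun ζ => Real.exp (-(ζ / (1 - ζ))) with he
  have he0 : e 0 = 1 := by simp [he]
  have hea : AnalyticAt ℝ e 0 :=
    (analyticAt_id.div (analyticAt_const.sub analyticAt_id) (by simp)).neg.rexp
  set f : ℝ → ℝ := fun ζ => G (e ζ) * (1 - ζ) ^ 2 with hf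
  have hfa : AnalyticAt ℝ f 0 :=
    (AnalyticAt.fun_comp (by rwa [he0]) hea).mul ((analyticAt_const.sub analyticAt_id).pow 2)
  have hf0 : f 0 = 0 := by simp [hf, he0, hG0]
  have hf1 : deriv f 0 = 0 := by
    have h1 : HasDerivAt (fun ζ => G (e ζ)) (0 * deriv e 0) 0 := by
      refine HasDerivAt.comp (h₂ := G) 0 ?_ hea.differentiableAt.hasDerivAt
      rwa [he0]
    have h2 := h1.mul (((hasDerivAt_id (0 : ℝ)).const_sub 1).pow 2)
    refine h2.deriv.trans ?_
    simp [he0, hG0]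
  have hp := hfa.hasFPowerSeriesAt
  set b : ℕ → ℝ := fun n => iteratedDeriv n f 0 / n.factorial with hb
  refine ⟨b, fun n => ?_⟩
  obtain ⟨u, hu, hfu⟩ := hp.exists_eq_sum_add (n + 1)
  simp only [FormalMultilinearSeries.coeff_ofScalars] at hfu
  have hlog : AnalyticAt ℝ Real.log 1 := analyticAt_log one_pos
  have h1l : AnalyticAt ℝ (fun η => 1 - Real.log η) 1 := analyticAt_const.sub hlog
  have hinner : AnalyticAt ℝ (fun η => -Real.log η / (1 - Real.log η)) 1 :=
    hlog.neg.div h1l (by simp)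
  refine ⟨fun η => (1 - Real.log η) ^ 2 * (-dslope Real.log 1 η / (1 - Real.log η)) ^ (n + 1) *
    u (-Real.log η / (1 - Real.log η)), ((h1l.pow 2).mul
      ((analyticAt_dslope_log.neg.div h1l (by simp)).pow _)).mul
      (AnalyticAt.fun_comp (by simpa using hu) hinner), fun η h0 h1 => ?_⟩
  have hl : Real.log η < 0 := Real.log_neg h0 h1
  set l := Real.log η with hldef
  have hpos : 0 < 1 - l := by linarith
  have hz : 1 - -l / (1 - l) = 1 / (1 - l) := by field_simp; ring
  have hez : e (-l / (1 - l)) = η := by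
    simp only [he]
    rw [hz, div_div_div_cancel_right₀ hpos.ne', div_one, neg_neg, hldef, Real.exp_log h0]
  have key := hfu (-l / (1 - l))
  simp only [hf] at key
  rw [hez, hz, sum_range_succ_eq_sum_Icc (by simp [hb, hf0]) (by simp [hb, hf1])] at key
  have hG : G η = (1 - l) ^ 2 * (G η * (1 / (1 - l)) ^ 2) := by field_simp
  rw [hG, key, mul_add, Finset.mul_sum]
  congr 1
  · refine Finset.sum_congr rfl fun k hk => ?_
    obtain ⟨m, rfl⟩ : ∃ m, k = m + 2 := ⟨k - 2, by have := (Finset.mem_Icc.1 hk).1; omega⟩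
    rw [Nat.add_sub_cancel, div_pow, pow_add (1 - l)]
    field_simp
  -- `dslope` extracts a factor `η - 1` from `log η`, so `ζ ^ (n + 1)` becomes `(η - 1) ^ (n + 1)`
  -- times an analytic function.
  · have : -l / (1 - l) = (η - 1) * (-dslope Real.log 1 η / (1 - l)) := by
      rw [hldef, log_eq η]
      ring
    nth_rw 1 [this]
    rw [mul_pow]
    ring

lemma isCoeffs_of_expansions {a b : ℕ → ℝ}
    (ha : ∀ n : ℕ, ∃ U : ℝ → ℝ, AnalyticAt ℝ U 1 ∧ ∀ η : ℝ, 1 / 2 < η →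
      G η = ∑ k ∈ Finset.Icc 2 n, a k * ((η - 1) ^ k / η ^ (k - 1)) + (η - 1) ^ (n + 1) * U η)
    (hb : ∀ n : ℕ, ∃ V : ℝ → ℝ, AnalyticAt ℝ V 1 ∧ ∀ η : ℝ, 0 < η → η < 1 →
      G η = ∑ k ∈ Finset.Icc 2 n, b k * ((-Real.log η) ^ k / (1 - Real.log η) ^ (k - 2)) +
        (η - 1) ^ (n + 1) * V η) : IsCoeffs a b := by
  intro n _
  obtain ⟨hGa, hG0, -⟩ := G_vanishes
  obtain ⟨U, hU, hGU⟩ := ha n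
  obtain ⟨V, hV, hGV⟩ := hb n
  have hG : ContDiffAt ℝ n G 1 := hGa.contDiffAt
  obtain ⟨hD, hDn⟩ := contDiffAt_of_eventually_eq_pow_mul (D := G - GSum a b n) (n := n)
    hU.contDiffAt hV.contDiffAt (by simp [hG0, GSum_one])
    (by
      filter_upwards [self_mem_nhdsWithin] with η (hη : 1 < η)
      rw [Pi.sub_apply, GSum_of_one_lt _ _ _ hη, hGU η (by linarith), add_sub_cancel_left])
    (by
      filter_upwards [self_mem_nhdsWithin, mem_nhdsWithin_of_mem_nhds (Ioi_mem_nhds one_pos)]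
        with η (hη : η < 1) (h0 : 0 < η)
      rw [Pi.sub_apply, GSum_of_lt_one _ _ _ h0 hη, hGV η h0 hη, add_sub_cancel_left])
  have hS : ContDiffAt ℝ n (GSum a b n) 1 := by
    simpa using hG.sub hD
  refine ⟨hG, hS, ?_⟩
  rw [iteratedDeriv_sub hG hS] at hDn
  exact sub_eq_zero.1 hDn

/-- By strong induction the two partial sums differ only in the `n`-th term. Its `n`-th derivative
at `1` is `n!` times the difference of the `a n` seen from the right, and of the `b n` seen from the
left. -/
lemma IsCoeffs.unique {a b a' b' : ℕ → ℝ} (h : IsCoeffs a b) (h' : IsCoeffs a' b') :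
    ∀ n : ℕ, 2 ≤ n → a' n = a n ∧ b' n = b n := by
  intro n
  induction n using Nat.strong_induction_on with
  | _ n ih =>
  intro hn
  obtain ⟨-, hS, hSn⟩ := h n (by omega)
  obtain ⟨-, hS', hSn'⟩ := h' n (by omega)
  have hD : ContDiffAt ℝ n (GSum a' b' n - GSum a b n) 1 := hS'.sub hS
  have hDn : iteratedDeriv n (GSum a' b' n - GSum a b n) 1 = 0 := by
    rw [iteratedDeriv_sub hS' hS, ← hSn, ← hSn', sub_self]
  have hfact : (n.factorial : ℝ) ≠ 0 := by exact_mod_cast n.factorial_ne_zero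
  have htail : ∀ (c c' : ℕ → ℝ) (φ : ℕ → ℝ), (∀ k < n, 2 ≤ k → c' k = c k) →
      ∑ k ∈ Finset.Icc 2 n, c' k * φ k - ∑ k ∈ Finset.Icc 2 n, c k * φ k =
        (c' n - c n) * φ n := by
    intro c c' φ hcc
    rw [← Finset.sum_sub_distrib, Finset.sum_eq_single_of_mem n (Finset.mem_Icc.2 ⟨hn, le_rfl⟩)]
    · ring
    · intro k hk hkn
      have hk' := Finset.mem_Icc.1 hk
      rw [hcc k (by omega) hk'.1, sub_self]
  constructor
  · have hu : ContDiffAt ℝ n (fun η : ℝ => (a' n - a n) / η ^ (n - 1)) 1 :=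
      contDiffAt_const.div (contDiffAt_id.pow _) (by simp)
    have hpow : ContDiffAt ℝ n (fun η : ℝ => (η - 1) ^ n) 1 := by fun_prop
    have := iteratedDeriv_eq_of_eventuallyEq_nhdsWithin (s := Ioi 1) isOpen_Ioi hD (hpow.mul hu) (by
      filter_upwards [self_mem_nhdsWithin] with η (hη : 1 < η)
      rw [Pi.sub_apply, GSum_of_one_lt _ _ _ hη, GSum_of_one_lt _ _ _ hη,
        htail a a' _ fun k hk hk2 => (ih k hk hk2).1]
      ring)
    rw [hDn, iteratedDeriv_sub_pow_mul hu] at this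
    have := (mul_eq_zero.1 this.symm).resolve_left hfact
    simpa [sub_eq_zero] using this
  · have hu : ContDiffAt ℝ n (fun η : ℝ => (b' n - b n) * ((-dslope Real.log 1 η) ^ n /
        (1 - Real.log η) ^ (n - 2))) 1 :=
      (contDiffAt_const.mul ((analyticAt_dslope_log.neg.pow n).div
        ((analyticAt_const.sub (analyticAt_log one_pos)).pow _) (by simp)).contDiffAt)
    have hpow : ContDiffAt ℝ n (fun η : ℝ => (η - 1) ^ n) 1 := by fun_prop
    have := iteratedDeriv_eq_of_eventuallyEq_nhdsWithin (s := Iio 1) isOpen_Iio hD (hpow.mul hu) (by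
      filter_upwards [self_mem_nhdsWithin, mem_nhdsWithin_of_mem_nhds (Ioi_mem_nhds one_pos)]
        with η (hη : η < 1) (h0 : 0 < η)
      rw [Pi.sub_apply, GSum_of_lt_one _ _ _ h0 hη, GSum_of_lt_one _ _ _ h0 hη,
        htail b b' _ fun k hk hk2 => (ih k hk hk2).2]
      have : (-Real.log η) ^ n = (η - 1) ^ n * (-dslope Real.log 1 η) ^ n := by
        rw [← mul_pow, mul_neg, ← log_eq]
      rw [this]
      ring)
    rw [hDn, iteratedDeriv_sub_pow_mul hu] at this
    have := (mul_eq_zero.1 this.symm).resolve_left hfact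
    simpa [sub_eq_zero] using this

end ExpBM

end

/-! ### The energy inequality for trajectories. -/

section

open Filter Topology Set MeasureTheory

lemma AbsolutelyContinuousOnInterval.lipschitzOnWith_comp {f g : ℝ → ℝ} {a b : ℝ}
    {K : NNReal} {s : Set ℝ} (hf : AbsolutelyContinuousOnInterval f a b)
    (hg : LipschitzOnWith K g s) (hs : MapsTo f (uIcc a b) s) :
    AbsolutelyContinuousOnInterval (fun x => g (f x)) a b := by
  rw [absolutelyContinuousOnInterval_iff] at hf ⊢
  intro ε hε
  obtain ⟨δ, hδ, h⟩ := hf (ε / (K + 1)) (by positivity)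
  refine ⟨δ, hδ, fun I hI hlt => ?_⟩
  have hlt' := h I hI hlt
  have hle : ∀ i ∈ Finset.range I.1, dist (g (f (I.2 i).1)) (g (f (I.2 i).2)) ≤
      (K + 1) * dist (f (I.2 i).1) (f (I.2 i).2) := fun i hi => by
    have hm := hI.1 i hi
    refine (hg.dist_le_mul _ (hs hm.1) _ (hs hm.2)).trans ?_
    gcongr
    linarith
  refine (Finset.sum_le_sum hle).trans_lt ?_
  rw [← Finset.mul_sum]
  rw [lt_div_iff₀ (by positivity)] at hlt'
  linarith

lemma AbsolutelyContinuousOnInterval.exp {f : ℝ → ℝ} {a b : ℝ}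
    (hf : AbsolutelyContinuousOnInterval f a b) :
    AbsolutelyContinuousOnInterval (fun x => Real.exp (f x)) a b := by
  obtain ⟨C, hC⟩ := hf.exists_bound
  obtain ⟨K, hK⟩ := (Real.contDiff_exp (n := 1)).contDiffOn.exists_lipschitzOnWith
    (s := Icc (-C) C) (by decide) (convex_Icc _ _) isCompact_Icc
  exact hf.lipschitzOnWith_comp hK fun x hx => abs_le.1 (hC x hx)

namespace ExpBM

section Extremal

variable {t T α c : ℝ} {v dv : ℝ → ℝ}

/-- The Euler–Lagrange equation: the derivative of the extremal control `q = -2v' / v` is a constant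
multiple of its trajectory `1 / v ^ 2`, the constant coming from the conserved energy `c`. -/
lemma hasDerivAt_neg_two_mul_logDeriv (hv : ∀ τ, HasDerivAt v (dv τ) τ)
    (hdv : ∀ τ, HasDerivAt dv (-(α ^ 2 * v τ)) τ)
    (hc : ∀ τ, α ^ 2 * v τ ^ 2 + dv τ ^ 2 = c) {τ : ℝ} (h : v τ ≠ 0) :
    HasDerivAt (fun τ => -2 * dv τ / v τ) (2 * c * (1 / v τ ^ 2)) τ := by
  refine (((hdv τ).const_mul (-2)).div (hv τ) h).congr_deriv ?_
  rw [← hc τ]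
  field_simp
  ring

lemma continuousOn_neg_two_mul_logDeriv (hv : ∀ τ, HasDerivAt v (dv τ) τ)
    (hdv : ∀ τ, HasDerivAt dv (-(α ^ 2 * v τ)) τ) (hpos : ∀ τ ∈ Icc t T, 0 < v τ) :
    ContinuousOn (fun τ => -2 * dv τ / v τ) (Icc t T) := fun τ hτ =>
  ((((hdv τ).const_mul (-2)).div (hv τ) (hpos τ hτ).ne').continuousAt).continuousWithinAt

lemma continuousOn_one_div_sq (hv : ∀ τ, HasDerivAt v (dv τ) τ)
    (hpos : ∀ τ ∈ Icc t T, 0 < v τ) : ContinuousOn (fun τ => 1 / v τ ^ 2) (Icc t T) :=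
  continuousOn_const.div (ContinuousOn.pow
    (fun τ _ => (hv τ).continuousAt.continuousWithinAt) 2) fun τ hτ => pow_ne_zero 2 (hpos τ hτ).ne'

lemma hasDerivAt_one_div_sq (hv : ∀ τ, HasDerivAt v (dv τ) τ) {τ : ℝ} (h : v τ ≠ 0) :
    HasDerivAt (fun τ => 1 / v τ ^ 2) (-2 * dv τ / v τ * (1 / v τ ^ 2)) τ := by
  refine ((hasDerivAt_const τ (1 : ℝ)).div ((hv τ).pow 2) (pow_ne_zero 2 h)).congr_deriv ?_
  simp only [Pi.pow_apply]
  field_simp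
  push_cast
  ring

lemma integral_one_div_sq (htT : t ≤ T) (hv : ∀ τ, HasDerivAt v (dv τ) τ)
    (hdv : ∀ τ, HasDerivAt dv (-(α ^ 2 * v τ)) τ) (hpos : ∀ τ ∈ Icc t T, 0 < v τ)
    (hc : ∀ τ, α ^ 2 * v τ ^ 2 + dv τ ^ 2 = c) :
    2 * c * ∫ τ in t..T, 1 / v τ ^ 2 = -2 * dv T / v T - -2 * dv t / v t := by
  rw [← intervalIntegral.integral_const_mul]
  refine intervalIntegral.integral_eq_sub_of_hasDerivAt (f := fun τ => -2 * dv τ / v τ)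
    (fun τ hτ => ?_) ?_
  · rw [uIcc_of_le htT] at hτ
    exact hasDerivAt_neg_two_mul_logDeriv hv hdv hc (hpos τ hτ).ne'
  · refine ContinuousOn.intervalIntegrable ?_
    rw [uIcc_of_le htT]
    exact continuousOn_const.mul (continuousOn_one_div_sq hv hpos)

lemma integral_neg_two_mul_logDeriv_sq (htT : t ≤ T) (hv : ∀ τ, HasDerivAt v (dv τ) τ)
    (hdv : ∀ τ, HasDerivAt dv (-(α ^ 2 * v τ)) τ) (hpos : ∀ τ ∈ Icc t T, 0 < v τ)
    (hc : ∀ τ, α ^ 2 * v τ ^ 2 + dv τ ^ 2 = c) :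
    ∫ τ in t..T, (-2 * dv τ / v τ) ^ 2 =
      2 * (-2 * dv T / v T - -2 * dv t / v t) - 4 * α ^ 2 * (T - t) := by
  rw [← integral_one_div_sq htT hv hdv hpos hc, ← intervalIntegral.integral_const_mul,
    ← intervalIntegral.integral_const_mul,
    show 4 * α ^ 2 * (T - t) = ∫ _ in t..T, 4 * α ^ 2 by
      rw [intervalIntegral.integral_const, smul_eq_mul, mul_comm],
    ← intervalIntegral.integral_sub _ intervalIntegrable_const]
  · refine intervalIntegral.integral_congr fun τ hτ => ?_
    rw [uIcc_of_le htT] at hτ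
    have := (hpos τ hτ).ne'
    simp only [← hc τ]
    field_simp
    ring
  · refine ContinuousOn.intervalIntegrable ?_
    rw [uIcc_of_le htT]
    exact continuousOn_const.mul (continuousOn_const.mul (continuousOn_one_div_sq hv hpos))

/-- Along any trajectory of `γ' = U γ`, the function `γ v ^ 2` is the exponential of the
primitive of `U - φ'`, where `φ = -2 log v`. -/
lemma mul_sq_eq_exp (htT : t ≤ T) {x₁ : ℝ} {U γ : ℝ → ℝ} (hv : ∀ τ, HasDerivAt v (dv τ) τ)
    (hdv : ∀ τ, HasDerivAt dv (-(α ^ 2 * v τ)) τ) (hpos : ∀ τ ∈ Icc t T, 0 < v τ)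
    (hU : IntervalIntegrable U volume t T) (hγc : ContinuousOn γ (Icc t T))
    (hγ : ∀ s ∈ Icc t T, γ s = x₁ + ∫ τ in t..s, U τ * γ τ) (hx : x₁ * v t ^ 2 = 1) :
    ∀ s ∈ Icc t T, γ s * v s ^ 2 = Real.exp (∫ τ in t..s, (U τ - -2 * dv τ / v τ)) := by
  have hu : uIcc t T = Icc t T := uIcc_of_le htT
  have htm : t ∈ uIcc t T := left_mem_uIcc
  have hUγ : IntervalIntegrable (fun τ => U τ * γ τ) volume t T :=
    hU.mul_continuousOn (by rwa [hu])
  have hp : IntervalIntegrable (fun τ => U τ - -2 * dv τ / v τ) volume t T :=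
    hU.sub (ContinuousOn.intervalIntegrable (by
      rw [hu]; exact continuousOn_neg_two_mul_logDeriv hv hdv hpos))
  set ψ : ℝ → ℝ := fun s => ∫ τ in t..s, (U τ - -2 * dv τ / v τ) with hψ
  set Γ : ℝ → ℝ := fun s => x₁ + ∫ τ in t..s, U τ * γ τ with hΓ
  have hconst : AbsolutelyContinuousOnInterval (fun _ : ℝ => x₁) t T :=
    (contDiff_const (n := 1)).contDiffOn.absolutelyContinuousOnInterval
  have hvac : AbsolutelyContinuousOnInterval (fun τ => v τ ^ 2) t T := by
    have hvc : ContDiff ℝ 1 v := by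
      rw [contDiff_one_iff_deriv]
      refine ⟨fun τ => (hv τ).differentiableAt, ?_⟩
      rw [funext fun τ => (hv τ).deriv]
      exact continuous_iff_continuousAt.2 fun τ => (hdv τ).continuousAt
    exact (hvc.pow 2).contDiffOn.absolutelyContinuousOnInterval
  have hψac : AbsolutelyContinuousOnInterval ψ t T :=
    hp.absolutelyContinuousOnInterval_intervalIntegral htm
  have hΓac : AbsolutelyContinuousOnInterval Γ t T :=
    hconst.add (hUγ.absolutelyContinuousOnInterval_intervalIntegral htm)
  -- `Γ v ^ 2 exp (-ψ)` is absolutely continuous with derivative zero almost everywhere, hence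
  -- constant, equal to its value `1` at `t`.
  have hkac := (hΓac.fun_mul hvac).fun_mul hψac.neg.exp
  obtain ⟨C, hC⟩ := hkac.const_of_ae_hasDerivAt_zero (by
    filter_upwards [hp.ae_hasDerivAt_integral, hUγ.ae_hasDerivAt_integral] with s h1 h2 hs
    have h3 := (((h2 hs t htm).const_add x₁).mul ((hv s).pow 2)).mul (h1 hs t htm).neg.exp
    refine h3.congr_deriv ?_
    rw [hu] at hs
    have h4 := (hpos s hs).ne'
    have h5 := hγ s hs
    simp only [Pi.neg_apply, Pi.mul_apply, Pi.pow_apply, ← h5]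
    field_simp
    push_cast
    ring)
  intro s hs
  have h1 := hC s (hu ▸ hs)
  have h0 := hC t htm
  simp only [hΓ, hψ, Pi.neg_apply, intervalIntegral.integral_same, add_zero, neg_zero,
    Real.exp_zero, mul_one, hx] at h0
  simp only [hΓ, Pi.neg_apply, ← hγ s hs, ← h0, Real.exp_neg] at h1
  field_simp at h1
  exact h1

/-- The extremal `-2 log v` minimizes the energy. -/
theorem integral_sq_le_of_trajectory (htT : t ≤ T) {x₁ : ℝ} {U γ : ℝ → ℝ}
    (hv : ∀ τ, HasDerivAt v (dv τ) τ)
    (hdv : ∀ τ, HasDerivAt dv (-(α ^ 2 * v τ)) τ) (hpos : ∀ τ ∈ Icc t T, 0 < v τ)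
    (hc : ∀ τ, α ^ 2 * v τ ^ 2 + dv τ ^ 2 = c)
    (hU : MemLp U 2 (volume.restrict (Icc t T))) (hγc : ContinuousOn γ (Icc t T))
    (hγ : ∀ s ∈ Icc t T, γ s = x₁ + ∫ τ in t..s, U τ * γ τ) (hx : x₁ * v t ^ 2 = 1)
    (hy : γ T * v T ^ 2 = 1) (hint : ∫ τ in t..T, γ τ = ∫ τ in t..T, 1 / v τ ^ 2) :
    ∫ τ in t..T, (-2 * dv τ / v τ) ^ 2 ≤ ∫ τ in t..T, U τ ^ 2 := by
  have hu : uIcc t T = Icc t T := uIcc_of_le htT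
  have htm : t ∈ uIcc t T := left_mem_uIcc
  have hc0 : 0 ≤ c := by rw [← hc t]; positivity
  have hUi : IntervalIntegrable U volume t T :=
    (intervalIntegrable_iff_integrableOn_Icc_of_le htT).2 (hU.integrable one_le_two)
  have hU2 : IntervalIntegrable (fun τ => U τ ^ 2) volume t T :=
    (intervalIntegrable_iff_integrableOn_Icc_of_le htT).2 hU.integrable_sq
  have hexp := mul_sq_eq_exp htT hv hdv hpos hUi hγc hγ hx
  have hqc := continuousOn_neg_two_mul_logDeriv hv hdv hpos
  have hsqc := continuousOn_one_div_sq hv hpos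
  set q : ℝ → ℝ := fun τ => -2 * dv τ / v τ with hq
  have hqi : IntervalIntegrable q volume t T := ContinuousOn.intervalIntegrable (by rwa [hu])
  have hp : IntervalIntegrable (fun τ => U τ - q τ) volume t T := hUi.sub hqi
  set ψ : ℝ → ℝ := fun s => ∫ τ in t..s, (U τ - q τ) with hψ
  have hψac : AbsolutelyContinuousOnInterval ψ t T :=
    hp.absolutelyContinuousOnInterval_intervalIntegral htm
  have hqd : ∀ τ ∈ Icc t T, HasDerivAt q (2 * c * (1 / v τ ^ 2)) τ := fun τ hτ =>
    hasDerivAt_neg_two_mul_logDeriv hv hdv hc (hpos τ hτ).ne'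
  have hqac : AbsolutelyContinuousOnInterval q t T := by
    obtain ⟨M, hM⟩ : ∃ M, ∀ τ ∈ Icc t T, ‖2 * c * (1 / v τ ^ 2)‖ ≤ M :=
      isCompact_Icc.exists_bound_of_continuousOn (continuousOn_const.mul hsqc)
    refine LipschitzOnWith.absolutelyContinuousOnInterval (K := M.toNNReal) ?_
    rw [hu]
    exact (convex_Icc t T).lipschitzOnWith_of_nnnorm_hasDerivWithin_le
      (fun τ hτ => (hqd τ hτ).hasDerivWithinAt) fun τ hτ => by
        rw [← NNReal.coe_le_coe, coe_nnnorm]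
        exact (hM τ hτ).trans (Real.le_coe_toNNReal _)
  have hψt : ψ t = 0 := by simp [hψ]
  have hψT : ψ T = 0 := by
    have := hexp T ⟨htT, le_rfl⟩
    rw [hy] at this
    exact Real.exp_eq_one_iff _ |>.1 this.symm
  -- The boundary terms vanish because the competitor shares both endpoints with `1 / v ^ 2`, so `∫
  -- q (U - q) = -∫ q' ψ`.
  have hparts := hqac.integral_mul_deriv_eq_deriv_mul hψac
  rw [hψt, hψT, mul_zero, mul_zero, sub_zero, zero_sub] at hparts
  have e1 : ∫ τ in t..T, q τ * deriv ψ τ = ∫ τ in t..T, q τ * (U τ - q τ) := by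
    refine intervalIntegral.integral_congr_ae ?_
    filter_upwards [hp.ae_hasDerivAt_integral] with s hs hsm
    rw [(hs (uIoc_subset_uIcc hsm) t htm).deriv]
  have e2 : ∫ τ in t..T, deriv q τ * ψ τ = ∫ τ in t..T, 2 * c * (1 / v τ ^ 2) * ψ τ := by
    refine intervalIntegral.integral_congr fun τ hτ => ?_
    simp only [(hqd τ (hu ▸ hτ)).deriv]
  have hγi : IntervalIntegrable γ volume t T := ContinuousOn.intervalIntegrable (by rwa [hu])
  have hsqi : IntervalIntegrable (fun τ => 1 / v τ ^ 2) volume t T :=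
    ContinuousOn.intervalIntegrable (by rwa [hu])
  -- From `1 + ψ ≤ exp ψ = γ v ^ 2`; the right side integrates to zero by the constraint `hint`.
  have e3 : ∫ τ in t..T, 2 * c * (1 / v τ ^ 2) * ψ τ ≤
      ∫ τ in t..T, 2 * c * (γ τ - 1 / v τ ^ 2) := by
    refine intervalIntegral.integral_mono_on htT ?_ ((hγi.sub hsqi).const_mul _) fun τ hτ => ?_
    · exact ContinuousOn.intervalIntegrable (by
        rw [hu]
        exact (continuousOn_const.mul hsqc).mul (hu ▸ hψac.continuousOn))
    · have h1 := Real.add_one_le_exp (ψ τ)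
      rw [← hexp τ hτ] at h1
      have h2 := hpos τ hτ
      have h3 : ψ τ ≤ γ τ * v τ ^ 2 - 1 := by linarith
      calc 2 * c * (1 / v τ ^ 2) * ψ τ ≤ 2 * c * (1 / v τ ^ 2) * (γ τ * v τ ^ 2 - 1) := by gcongr
        _ = 2 * c * (γ τ - 1 / v τ ^ 2) := by field_simp
  rw [intervalIntegral.integral_const_mul, intervalIntegral.integral_sub hγi hsqi, hint, sub_self,
    mul_zero] at e3
  have hcross : 0 ≤ ∫ τ in t..T, q τ * (U τ - q τ) := by
    rw [← e1, hparts, e2]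
    linarith
  have hq2i : IntervalIntegrable (fun τ => q τ ^ 2) volume t T :=
    ContinuousOn.intervalIntegrable (by rw [hu]; exact hqc.pow 2)
  have hqpi : IntervalIntegrable (fun τ => q τ * (U τ - q τ)) volume t T :=
    hp.continuousOn_mul (by rwa [hu])
  have e4 : ∫ τ in t..T, (q τ ^ 2 + 2 * (q τ * (U τ - q τ))) ≤ ∫ τ in t..T, U τ ^ 2 :=
    intervalIntegral.integral_mono_on htT (hq2i.add (hqpi.const_mul 2)) hU2 fun τ _ => by
      nlinarith [sq_nonneg (U τ - q τ)]
  rw [intervalIntegral.integral_add hq2i (hqpi.const_mul 2),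
    intervalIntegral.integral_const_mul] at e4
  linarith

end Extremal

end ExpBM

end

/-! ### The explicit extremal and the minimal cost. -/

section

open Filter Topology Set MeasureTheory

namespace ExpBM

/-- The solution of `v'' = -(s / (T - t)) ^ 2 v` on `[t, T]` with boundary values `v₀`, `v₁`. -/
noncomputable def interp (s t T v₀ v₁ τ : ℝ) : ℝ :=
  (v₀ * Real.sin (s / (T - t) * (T - τ)) + v₁ * Real.sin (s / (T - t) * (τ - t))) / Real.sin s

/-- The derivative of `interp`. -/
noncomputable def interpDeriv (s t T v₀ v₁ τ : ℝ) : ℝ :=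
  s / (T - t) * (v₁ * Real.cos (s / (T - t) * (τ - t)) - v₀ * Real.cos (s / (T - t) * (T - τ))) /
    Real.sin s

section Interp

variable {s t T v₀ v₁ : ℝ}

lemma hasDerivAt_interp (τ : ℝ) :
    HasDerivAt (interp s t T v₀ v₁) (interpDeriv s t T v₀ v₁ τ) τ := by
  have h1 : HasDerivAt (fun τ => s / (T - t) * (T - τ)) (s / (T - t) * -1) τ :=
    ((hasDerivAt_id τ).const_sub T).const_mul _
  have h2 : HasDerivAt (fun τ => s / (T - t) * (τ - t)) (s / (T - t) * 1) τ :=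
    ((hasDerivAt_id τ).sub_const t).const_mul _
  refine (((h1.sin.const_mul v₀).add (h2.sin.const_mul v₁)).div_const _).congr_deriv ?_
  rw [interpDeriv]
  ring

lemma hasDerivAt_interpDeriv (τ : ℝ) : HasDerivAt (interpDeriv s t T v₀ v₁)
    (-((s / (T - t)) ^ 2 * interp s t T v₀ v₁ τ)) τ := by
  have h1 : HasDerivAt (fun τ => s / (T - t) * (T - τ)) (s / (T - t) * -1) τ :=
    ((hasDerivAt_id τ).const_sub T).const_mul _
  have h2 : HasDerivAt (fun τ => s / (T - t) * (τ - t)) (s / (T - t) * 1) τ :=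
    ((hasDerivAt_id τ).sub_const t).const_mul _
  refine ((((h2.cos.const_mul v₁).sub (h1.cos.const_mul v₀)).const_mul _).div_const _).congr_deriv ?_
  rw [interp]
  ring

lemma interp_left (htT : t < T) (hs : Real.sin s ≠ 0) : interp s t T v₀ v₁ t = v₀ := by
  have : T - t ≠ 0 := (sub_pos.2 htT).ne'
  simp [interp, this, hs]

lemma interp_right (htT : t < T) (hs : Real.sin s ≠ 0) : interp s t T v₀ v₁ T = v₁ := by
  have : T - t ≠ 0 := (sub_pos.2 htT).ne'
  simp [interp, this, hs]

lemma interpDeriv_left (htT : t < T) : interpDeriv s t T v₀ v₁ t =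
    s / (T - t) * (v₁ - v₀ * Real.cos s) / Real.sin s := by
  have : T - t ≠ 0 := (sub_pos.2 htT).ne'
  simp [interpDeriv, this]

lemma interpDeriv_right (htT : t < T) : interpDeriv s t T v₀ v₁ T =
    s / (T - t) * (v₁ * Real.cos s - v₀) / Real.sin s := by
  have : T - t ≠ 0 := (sub_pos.2 htT).ne'
  simp [interpDeriv, this]

/-- Both sine arguments lie in `[0, s]`, with `s < π`, and they do not vanish together. -/
lemma interp_pos (htT : t < T) (hs : 0 < s) (hsπ : s < Real.pi) (h₀ : 0 < v₀) (h₁ : 0 < v₁)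
    {τ : ℝ} (hτ : τ ∈ Icc t T) : 0 < interp s t T v₀ v₁ τ := by
  have hL : 0 < T - t := sub_pos.2 htT
  have hα : 0 < s / (T - t) := div_pos hs hL
  have hαL : s / (T - t) * (T - t) = s := div_mul_cancel₀ _ hL.ne'
  have hsin := Real.sin_pos_of_pos_of_lt_pi hs hsπ
  have hn1 : 0 ≤ Real.sin (s / (T - t) * (T - τ)) :=
    Real.sin_nonneg_of_nonneg_of_le_pi (mul_nonneg hα.le (sub_nonneg.2 hτ.2))
      (by nlinarith [hτ.1, hτ.2])
  refine div_pos ?_ hsin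
  rcases hτ.1.eq_or_lt with h | h
  · rw [← h, hαL]
    simp only [sub_self, mul_zero, Real.sin_zero, add_zero]
    positivity
  · have : 0 < Real.sin (s / (T - t) * (τ - t)) :=
      Real.sin_pos_of_pos_of_lt_pi (mul_pos hα (sub_pos.2 h)) (by nlinarith [hτ.1, hτ.2])
    positivity

lemma interp_energy (τ : ℝ) : (s / (T - t)) ^ 2 * interp s t T v₀ v₁ τ ^ 2 +
    interpDeriv s t T v₀ v₁ τ ^ 2 =
      (s / (T - t)) ^ 2 * interp s t T v₀ v₁ t ^ 2 + interpDeriv s t T v₀ v₁ t ^ 2 := by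
  have hd : ∀ τ, HasDerivAt (fun τ => (s / (T - t)) ^ 2 * interp s t T v₀ v₁ τ ^ 2 +
      interpDeriv s t T v₀ v₁ τ ^ 2) 0 τ := fun τ => by
    refine ((((hasDerivAt_interp τ).pow 2).const_mul _).add
      ((hasDerivAt_interpDeriv τ).pow 2)).congr_deriv ?_
    push_cast
    ring
  exact is_const_of_deriv_eq_zero (fun τ => (hd τ).differentiableAt) (fun τ => (hd τ).deriv) τ t

end Interp

/-- The minimal cost for `h > 1`. -/
theorem isLeast_costs {σ t x₁ x₂ T y₁ y₂ : ℝ} (hσ : 0 < σ) (htT : t < T) (hx₁ : 0 < x₁)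
    (hy₁ : 0 < y₁) (hx₂ : x₂ < y₂) (hh : 1 < h t x₁ x₂ T y₁ y₂) :
    IsLeast (costs σ t x₁ x₂ T y₁ y₂) (4 / (σ ^ 2 * (T - t)) *
      (h t x₁ x₂ T y₁ y₂ * (Real.sqrt (y₁ / x₁) + Real.sqrt (x₁ / y₁) - 2)
        + G (h t x₁ x₂ T y₁ y₂))) := by
  obtain ⟨s, hs, hsπ, hηs, -, hG⟩ := exists_G_eq_of_one_lt hh
  have hsin := Real.sin_pos_of_pos_of_lt_pi hs hsπ
  have hL : 0 < T - t := sub_pos.2 htT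
  have hA : 0 < y₂ - x₂ := sub_pos.2 hx₂
  rw [hG, Real.sqrt_div' _ hx₁.le, Real.sqrt_div' _ hy₁.le]
  have hη : h t x₁ x₂ T y₁ y₂ = s / Real.sin s := by
    rw [eq_div_iff hsin.ne', hηs]
  have hA' : y₂ - x₂ = (T - t) * (Real.sqrt x₁ * Real.sqrt y₁) * Real.sin s / s := by
    rw [h, Real.sqrt_mul hx₁.le] at hη
    field_simp at hη ⊢
    linarith
  rw [hη]
  clear hG hηs hh hη
  obtain ⟨X, hX, rfl⟩ : ∃ X, 0 < X ∧ x₁ = X ^ 2 :=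
    ⟨Real.sqrt x₁, Real.sqrt_pos.2 hx₁, (Real.sq_sqrt hx₁.le).symm⟩
  obtain ⟨Y, hY, rfl⟩ : ∃ Y, 0 < Y ∧ y₁ = Y ^ 2 :=
    ⟨Real.sqrt y₁, Real.sqrt_pos.2 hy₁, (Real.sq_sqrt hy₁.le).symm⟩
  rw [Real.sqrt_sq hX.le, Real.sqrt_sq hY.le] at *
  have hv := hasDerivAt_interp (s := s) (t := t) (T := T) (v₀ := 1 / X) (v₁ := 1 / Y)
  have hdv := hasDerivAt_interpDeriv (s := s) (t := t) (T := T) (v₀ := 1 / X) (v₁ := 1 / Y)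
  have hpos := fun τ hτ => interp_pos htT hs hsπ (one_div_pos.2 hX) (one_div_pos.2 hY) (τ := τ) hτ
  have hc := interp_energy (s := s) (t := t) (T := T) (v₀ := 1 / X) (v₁ := 1 / Y)
  have hvt := interp_left (v₀ := 1 / X) (v₁ := 1 / Y) htT hsin.ne'
  have hvT := interp_right (v₀ := 1 / X) (v₁ := 1 / Y) htT hsin.ne'
  have hdvt := interpDeriv_left (s := s) (v₀ := 1 / X) (v₁ := 1 / Y) htT
  have hdvT := interpDeriv_right (s := s) (v₀ := 1 / X) (v₁ := 1 / Y) htT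
  set v := interp s t T (1 / X) (1 / Y)
  set dv := interpDeriv s t T (1 / X) (1 / Y)
  set c := (s / (T - t)) ^ 2 * v t ^ 2 + dv t ^ 2 with hcdef
  have hc0 : 0 < c := by
    have h1 : 0 < (s / (T - t)) ^ 2 * v t ^ 2 := by rw [hvt]; positivity
    nlinarith [sq_nonneg (dv t)]
  have hqdiff : -2 * dv T / v T - -2 * dv t / v t =
      2 * s / ((T - t) * Real.sin s) * (X / Y + Y / X - 2 * Real.cos s) := by
    rw [hvt, hvT, hdvt, hdvT]
    field_simp
    ring
  -- Here `h = s / sin s` enters: the frequency `s / (T - t)` is the one for which the extremal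
  -- covers exactly `y₂ - x₂`.
  have hgint : ∫ τ in t..T, 1 / v τ ^ 2 = y₂ - x₂ := by
    have h1 := integral_one_div_sq htT.le hv hdv hpos hc
    have h2 : 2 * c * (y₂ - x₂) = -2 * dv T / v T - -2 * dv t / v t := by
      rw [hqdiff, hA', hcdef, hvt, hdvt]
      have := Real.sin_sq_add_cos_sq s
      field_simp
      linear_combination Y ^ 2 * this
    exact mul_left_cancel₀ (by positivity : (2 * c) ≠ 0) (h1.trans h2.symm)
  have hcost : 1 / σ ^ 2 * ∫ τ in t..T, (-2 * dv τ / v τ) ^ 2 = 4 / (σ ^ 2 * (T - t)) *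
      (s / Real.sin s * (Y / X + X / Y - 2) +
        (2 * (s / Real.sin s) * (1 - Real.cos s) - s ^ 2)) := by
    rw [integral_neg_two_mul_logDeriv_sq htT.le hv hdv hpos hc, hqdiff]
    field_simp
    ring
  rw [← hcost]
  have hqc := continuousOn_neg_two_mul_logDeriv hv hdv hpos
  have hsqc := continuousOn_one_div_sq hv hpos
  constructor
  -- The control `σ⁻¹ q` drives `γ₁ = 1 / v ^ 2`, which has the right endpoints since `v t = 1 / X`
  -- and `v T = 1 / Y`.
  · refine ⟨fun τ => σ⁻¹ * (-2 * dv τ / v τ), ⟨?_, fun τ => 1 / v τ ^ 2,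
      fun τ => x₂ + ∫ τ' in t..τ, 1 / v τ' ^ 2, hsqc, ?_, fun s hs => ?_, fun s _ => rfl, ?_, ?_⟩, ?_⟩
    · have h1 : ContinuousOn (fun τ => σ⁻¹ * (-2 * dv τ / v τ)) (Icc t T) :=
        continuousOn_const.mul hqc
      exact (memLp_two_iff_integrable_sq (h1.aestronglyMeasurable measurableSet_Icc)).2
        (h1.pow 2).integrableOn_Icc
    · exact continuousOn_const.add (intervalIntegral.continuousOn_primitive_interval
        (by rw [uIcc_of_le htT.le]; exact hsqc.integrableOn_Icc) |>.mono
          (by rw [uIcc_of_le htT.le]))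
    · have hsub : uIcc t s ⊆ Icc t T := by
        rw [uIcc_of_le hs.1]
        exact Icc_subset_Icc_right hs.2
      have h1 := intervalIntegral.integral_eq_sub_of_hasDerivAt (a := t) (b := s)
        (fun τ hτ => hasDerivAt_one_div_sq hv (hpos τ (hsub hτ)).ne')
        ((hqc.mul hsqc).mono hsub).intervalIntegrable
      have h2 : ∀ τ, σ * (σ⁻¹ * (-2 * dv τ / v τ)) = -2 * dv τ / v τ := fun τ => by
        rw [mul_inv_cancel_left₀ hσ.ne']
      simp only [h2, h1, hvt]
      field_simp
      ring
    · simp only [hvT]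
      field_simp
    · simp only [hgint]
      ring
    · rw [← intervalIntegral.integral_const_mul]
      refine intervalIntegral.integral_congr fun τ _ => ?_
      simp only [sq_abs]
      field_simp
  · rintro _ ⟨ω, ⟨hω, γ₁, γ₂, hγc, -, hγ₁, hγ₂, hγT, hγT₂⟩, rfl⟩
    have htTm : T ∈ Icc t T := ⟨htT.le, le_rfl⟩
    have hle := integral_sq_le_of_trajectory htT.le hv hdv hpos hc (hω.const_mul σ) hγc hγ₁
      (by rw [hvt]; field_simp) (by rw [hvT, hγT]; field_simp)
      (by rw [hgint, ← hγT₂, hγ₂ T htTm]; ring)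
    have hsq : ∀ τ, (σ * ω τ) ^ 2 = σ ^ 2 * |ω τ| ^ 2 := fun τ => by rw [mul_pow, sq_abs]
    simp only [hsq, intervalIntegral.integral_const_mul] at hle
    rw [one_div, inv_mul_le_iff₀ (by positivity)]
    exact hle

end ExpBM

end

theorem theorem3p3 :
    ∃ a b : ℕ → ℝ,
      -- the coefficients exist and are determined, for `n ≥ 2`, by the equations at `η = 1`
      ExpBM.IsCoeffs a b ∧
      (∀ a' b' : ℕ → ℝ, ExpBM.IsCoeffs a' b' → ∀ n : ℕ, 2 ≤ n → a' n = a n ∧ b' n = b n) ∧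
      -- pointwise convergence of the series to `G` on `(1, ∞)`
      (∀ η : ℝ, 1 < η →
        Filter.Tendsto (fun N : ℕ => ExpBM.GSum a b N η) Filter.atTop (nhds (ExpBM.G η))) ∧
      -- `Ψ` is an attained minimum, `G` is the function in its decomposition, and `Ψ_N → Ψ`
      (∀ σ t x₁ x₂ T y₁ y₂ : ℝ, 0 < σ → t < T → 0 < x₁ → 0 < y₁ → x₂ < y₂ →
        1 < ExpBM.h t x₁ x₂ T y₁ y₂ →
        IsLeast (ExpBM.costs σ t x₁ x₂ T y₁ y₂) (ExpBM.Psi σ t x₁ x₂ T y₁ y₂) ∧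
        ExpBM.Psi σ t x₁ x₂ T y₁ y₂ =
          4 / (σ ^ 2 * (T - t)) *
            (ExpBM.h t x₁ x₂ T y₁ y₂ * (Real.sqrt (y₁ / x₁) + Real.sqrt (x₁ / y₁) - 2)
              + ExpBM.G (ExpBM.h t x₁ x₂ T y₁ y₂)) ∧
        Filter.Tendsto (fun N : ℕ => ExpBM.PsiN a b N σ t x₁ x₂ T y₁ y₂) Filter.atTop
          (nhds (ExpBM.Psi σ t x₁ x₂ T y₁ y₂))) ∧
      -- `F(ξ) = (1 - ξ) G(1 / (1 - ξ))` is holomorphic on the unit disc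
      (∃ F : ℂ → ℂ, DifferentiableOn ℂ F (Metric.ball (0 : ℂ) 1) ∧
        ∀ ξ : ℝ, |ξ| < 1 → F (ξ : ℂ) = (((1 - ξ) * ExpBM.G (1 / (1 - ξ)) : ℝ) : ℂ)) := by
  obtain ⟨a, ha, hconv⟩ := ExpBM.exists_expansion_sub_one
  obtain ⟨b, hb⟩ := ExpBM.exists_expansion_log
  have hlim : ∀ η : ℝ, 1 < η →
      Filter.Tendsto (fun N : ℕ => ExpBM.GSum a b N η) Filter.atTop (nhds (ExpBM.G η)) :=
    fun η hη => (hconv η hη).congr fun N => (ExpBM.GSum_of_one_lt a b N hη).symm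
  have hcoeffs := ExpBM.isCoeffs_of_expansions ha hb
  refine ⟨a, b, hcoeffs, fun a' b' h' => hcoeffs.unique h', hlim, ?_, ?_⟩
  · intro σ t x₁ x₂ T y₁ y₂ hσ htT hx₁ hy₁ hx₂ hh
    have hleast := ExpBM.isLeast_costs hσ htT hx₁ hy₁ hx₂ hh
    have hΨ := hleast.csInf_eq
    rw [← ExpBM.Psi] at hΨ
    refine ⟨hΨ ▸ hleast, hΨ, ?_⟩
    rw [hΨ]
    exact ((hlim _ hh).const_add _).const_mul _
  · obtain ⟨F, hF, -, -, hFG⟩ := ExpBM.exists_holomorphic_extension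
    exact ⟨F, hF, hFG⟩
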